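/- Let $k\ge 1$ and let $\mathcal{E}\subset J^k(W,N)$, $W=\mathbb{R}^n$, $N=\mathbb{R}^m$, be a smooth embedded submanifold (a system of PDEs). Let $\pi_k:J^k(W,N)\to W$ and $\pi_{k,k-1}:J^k\to J^{k-1}$ be the natural projections, let $\mathcal{C}=\bigcap_{|\sigma|<k,\,j}\operatorname{Ker}\bigl(du^j_\sigma-\sum_i u^j_{\sigma+1_i}dx^i\bigr)\subset TJ^k$ be the Cartan distribution, and let $\mathcal{C}_{\mathcal{E}}=\mathcal{C}\cap T\mathcal{E}$ be the induced Cartan distribution. For $a\in\mathcal{E}$ let $g_k(a)=T_a\mathcal{E}\cap\operatorname{Ker}(d\pi_{k,k-1})\subset S^kT^*W\otimes N$ be the symbol, with prolongations $g_{i+1}=\{f\in S^{i+1}T^*W\otimes N: w\lrcorner f\in g_i\ \forall w\in TW\}$ for $i\ge k$. Assume that $\mathcal{E}$ is involutive, i.e. at every point the Spencer cohomology groups of the symbol, $H^{i,j}$ (the cohomology at $g_i\otimes\Lambda^jT^*W$ of the Spencer $\delta$-complex), vanish for all $i\ge k$, and the first prolongation $\mathcal{E}^{(1)}\subset J^{k+1}$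 projects onto $\mathcal{E}$. Here $\mathcal{E}^{(1)}$ is the set of $(k+1)$-jets over points $a\in\mathcal{E}$ for which the horizontal $n$-plane spanned by the total derivatives is contained in $T_a\mathcal{E}$. Assume also that $\mathcal{E}$ is of class $\omega=1$, i.e. at every point $\dim g_i=1$ for all sufficiently large $i$. A point $[p]$ of the projectivized cotangent space $PT^*W$ is called characteristic at $a\in\mathcal{E}$ if $p^k\otimes v\in g_k(a)$ for some $v\in N$, $v\neq0$. Then $\mathcal{C}_{\mathcal{E}}$ is a smooth distribution of rank $n+1$ on $\mathcal{E}$, and at every point of $\mathcal{E}$ there is exactly one characteristic covector $p\in PT^*W$. Moreover, there is a unique smooth subdistribution $\Pi\subset\mathcal{C}_{\mathcal{E}}$ of rank $n-1$ such that $d\pi_k(\Pi)=p^\perp\subset TW$ at every point of $\mathcal{E}$ and $\Pi$ consists of Cauchy characteristics of $\mathcal{C}_{\mathcal{E}}$; that is, every local smooth section $X$ of $\Pi$ satisfies $[X,Y]\in\Gamma(\mathcal{C}_{\mathcal{E}})$ for every local smooth section $Y$ of $\mathcal{C}_{\mathcal{E}}$. -/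

import Mathlib

open scoped Manifold ContDiff

noncomputable section

namespace JetPDE

/-! ### Jets of maps `ℝⁿ → ℝᵐ` -/

/-- Multi-indices `σ` in `n` variables with `|σ| ≤ k`. -/
abbrev MultiIndex (n k : ℕ) : Type := {σ : Fin n → ℕ // ∑ i, σ i ≤ k}

instance instFiniteMultiIndex (n k : ℕ) : Finite (MultiIndex n k) :=
  Finite.of_injective
    (fun σ : MultiIndex n k => fun i : Fin n =>
      (⟨σ.1 i, Nat.lt_succ_of_le
        ((Finset.single_le_sum (fun _ _ => Nat.zero_le _) (Finset.mem_univ i)).trans σ.2)⟩ :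
        Fin (k + 1)))
    (by
      intro σ τ h
      apply Subtype.ext
      funext i
      exact congrArg Fin.val (congrFun h i))

instance instFintypeMultiIndex (n k : ℕ) : Fintype (MultiIndex n k) := Fintype.ofFinite _

/-- The jet space `J^k(ℝⁿ, ℝᵐ)` in its canonical global coordinates: a point is a pair
`(x, u)` with `x = (xⁱ)` and `u = (uʲ_σ)`, `|σ| ≤ k`. Its smooth structure is that of a
finite-dimensional vector space, and all its tangent spaces are the space itself. -/
abbrev JetSpace (n m k : ℕ) : Type := (Fin n → ℝ) × (MultiIndex n k → Fin m → ℝ)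

theorem sum_add_single {n : ℕ} (σ : Fin n → ℕ) (i : Fin n) :
    ∑ l, (σ + Pi.single i 1 : Fin n → ℕ) l = (∑ l, σ l) + 1 := by
  simp [Finset.sum_add_distrib]

/-- The multi-index `σ + 1_i`, for `|σ| < k`. -/
def raise {n k : ℕ} (σ : Fin n → ℕ) (hσ : ∑ l, σ l < k) (i : Fin n) : MultiIndex n k :=
  ⟨σ + Pi.single i 1, by rw [sum_add_single]; exact hσ⟩

/-- The natural projection `π_{k+1,k} : J^{k+1} → J^k`. -/
def truncate {n m k : ℕ} (θ : JetSpace n m (k + 1)) : JetSpace n m k :=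
  (θ.1, fun σ => θ.2 ⟨σ.1, σ.2.trans (Nat.le_succ k)⟩)

/-- The total derivative `D_{xⁱ} = ∂_{xⁱ} + ∑_{|σ| ≤ k} uʲ_{σ+1_i} ∂_{uʲ_σ}`, a tangent vector to
`J^k` at the projection of the `(k+1)`-jet `θ`. -/
def totalDerivative {n m k : ℕ} (θ : JetSpace n m (k + 1)) (i : Fin n) : JetSpace n m k :=
  (Pi.single i 1, fun σ => θ.2 (raise σ.1 (Nat.lt_succ_of_le σ.2) i))

/-- The contact form `θʲ_σ = duʲ_σ - ∑ uʲ_{σ+1_i} dxⁱ` (`|σ| < k`) at the `k`-jet `a`. -/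
def contactForm {n m k : ℕ} (a : JetSpace n m k) (σ : Fin n → ℕ) (hσ : ∑ l, σ l < k)
    (j : Fin m) : JetSpace n m k →ₗ[ℝ] ℝ where
  toFun v := v.2 ⟨σ, hσ.le⟩ j - ∑ i, a.2 (raise σ hσ i) j * v.1 i
  map_add' v w := by
    simp only [Prod.fst_add, Prod.snd_add, Pi.add_apply, mul_add, Finset.sum_add_distrib]
    ring
  map_smul' c v := by
    simp only [Prod.smul_fst, Prod.smul_snd, Pi.smul_apply, smul_eq_mul, RingHom.id_apply,
      mul_sub, Finset.mul_sum]
    congr 1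
    exact Finset.sum_congr rfl fun i _ => by ring

/-- The Cartan distribution on `J^k` at `a`: the annihilator of all contact forms `θʲ_σ`,
`|σ| < k`. -/
def cartan {n m k : ℕ} (a : JetSpace n m k) : Submodule ℝ (JetSpace n m k) :=
  ⨅ (σ : Fin n → ℕ) (hσ : ∑ l, σ l < k) (j : Fin m), LinearMap.ker (contactForm a σ hσ j)

/-! ### Symbols and the Spencer complex -/

/-- Coefficient arrays `(fʲ_σ)` over all multi-indices. The symmetric tensors `SˡT* ⊗ ℝᵐ`
(`T = ℝⁿ`) are the arrays supported on `|σ| = l`: `f_σ ∈ ℝᵐ` is the value of the symmetric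
`l`-linear map on the basis vectors, `e_i` being repeated `σ i` times. -/
abbrev SymTensor (n m : ℕ) : Type := (Fin n → ℕ) → Fin m → ℝ

/-- `SˡT* ⊗ ℝᵐ`. -/
def homogeneous (n m l : ℕ) : Submodule ℝ (SymTensor n m) where
  carrier := {f | ∀ σ, ∑ i, σ i ≠ l → f σ = 0}
  add_mem' {f g} hf hg σ hσ := by
    rw [Pi.add_apply, hf σ hσ, hg σ hσ, add_zero]
  zero_mem' _ _ := rfl
  smul_mem' c f hf σ hσ := by
    rw [Pi.smul_apply, hf σ hσ, smul_zero]

/-- The contraction `T ⊗ S^{l+1}T* ⊗ ℝᵐ → SˡT* ⊗ ℝᵐ`, `(w ⌟ f)_σ = ∑ wⁱ f_{σ+1_i}`. -/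
def contract (n m : ℕ) : (Fin n → ℝ) →ₗ[ℝ] SymTensor n m →ₗ[ℝ] SymTensor n m :=
  LinearMap.mk₂ ℝ (fun w f σ => ∑ i, w i • f (σ + Pi.single i 1))
    (fun w w' f => by
      funext σ; simp only [Pi.add_apply, add_smul, Finset.sum_add_distrib])
    (fun c w f => by
      funext σ; simp only [Pi.smul_apply, smul_assoc, Finset.smul_sum])
    (fun w f g => by
      funext σ; simp only [Pi.add_apply, smul_add, Finset.sum_add_distrib])
    (fun c w f => by
      funext σ; simp only [Pi.smul_apply, Finset.smul_sum, smul_comm c])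

/-- The decomposable tensor `pˡ ⊗ v ∈ SˡT* ⊗ ℝᵐ`. -/
def powTensor {n m : ℕ} (p : Module.Dual ℝ (Fin n → ℝ)) (l : ℕ) (v : Fin m → ℝ) :
    SymTensor n m :=
  fun σ => if ∑ i, σ i = l then (∏ i, p (Pi.single i 1) ^ σ i) • v else 0

/-- The prolongations `g_{k+l} = (SˡT* ⊗ g_k) ∩ (S^{k+l}T* ⊗ ℝᵐ)` of a symbol
`g_k ⊆ SᵏT* ⊗ ℝᵐ`, defined recursively by
`g_{i+1} = {f ∈ S^{i+1}T* ⊗ ℝᵐ : w ⌟ f ∈ g_i for all w ∈ T}`. -/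
def prolongedSymbol {n m : ℕ} (k : ℕ) (g : Submodule ℝ (SymTensor n m)) :
    ℕ → Submodule ℝ (SymTensor n m)
  | 0 => g
  | l + 1 => homogeneous n m (k + l + 1) ⊓
      ⨅ w : Fin n → ℝ, (prolongedSymbol k g l).comap (contract n m w)

/-- The Spencer differential `δ : SⁱT* ⊗ ℝᵐ ⊗ ΛʲT* → S^{i-1}T* ⊗ ℝᵐ ⊗ Λ^{j+1}T*`,
`(δα)(w₀, …, w_j) = ∑ (-1)ˢ w_s ⌟ α(w₀, …, ŵ_s, …, w_j)`. -/
def spencer {n m j : ℕ} (α : (Fin n → ℝ) [⋀^Fin j]→ₗ[ℝ] SymTensor n m) :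
    (Fin n → ℝ) [⋀^Fin (j + 1)]→ₗ[ℝ] SymTensor n m :=
  AlternatingMap.alternatizeUncurryFin
    { toFun := fun w => (contract n m w).compAlternatingMap α
      map_add' := fun w w' => by ext; simp
      map_smul' := fun c w => by ext; simp }

/-- A symbol `g_k ⊆ SᵏT* ⊗ ℝᵐ` is involutive if its Spencer cohomology groups
`H^{i,j}`, i.e. the cohomology of `g_{i+1} ⊗ Λ^{j-1}T* → g_i ⊗ ΛʲT* → S^{i-1}T* ⊗ ℝᵐ ⊗ Λ^{j+1}T*`
at the middle term, vanish for all `i ≥ k` and `j ≥ 1`. (For `j = 0` and `i ≥ 1` they always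
vanish: a tensor of positive degree all of whose contractions are zero is zero.) -/
def IsInvolutiveSymbol {n m : ℕ} (k : ℕ) (g : Submodule ℝ (SymTensor n m)) : Prop :=
  ∀ (l j : ℕ) (α : (Fin n → ℝ) [⋀^Fin (j + 1)]→ₗ[ℝ] SymTensor n m),
    (∀ w, α w ∈ prolongedSymbol k g l) → spencer α = 0 →
      ∃ η : (Fin n → ℝ) [⋀^Fin j]→ₗ[ℝ] SymTensor n m,
        (∀ w, η w ∈ prolongedSymbol k g (l + 1)) ∧ spencer η = α

/-- The vertical vector `∑_{|σ| ≤ k} fʲ_σ ∂_{uʲ_σ}`. On `SᵏT* ⊗ ℝᵐ` this is the standard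
identification with the vertical space `Ker(dπ_{k,k-1})`. -/
def verticalVector (n m k : ℕ) : SymTensor n m →ₗ[ℝ] JetSpace n m k where
  toFun f := (0, fun σ => f σ.1)
  map_add' f g := by ext <;> simp
  map_smul' c f := by ext <;> simp

/-! ### Distributions on a manifold -/

section Distributions

variable {d : ℕ} {M : Type*} [TopologicalSpace M] [ChartedSpace (EuclideanSpace ℝ (Fin d)) M]
  [IsManifold (𝓡 d) ∞ M]

/-- `X` restricts to a smooth vector field on `U`. -/
def IsSmoothFieldOn (U : Set M) (X : (x : M) → TangentSpace (𝓡 d) x) : Prop :=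
  ContMDiffOn (𝓡 d) (𝓡 d).tangent ∞ (fun x => (⟨x, X x⟩ : TangentBundle (𝓡 d) M)) U

/-- `D` is a smooth distribution of rank `r`: near every point it is spanned by `r` pointwise
linearly independent smooth vector fields. -/
def IsSmoothDistribution (r : ℕ) (D : (x : M) → Submodule ℝ (TangentSpace (𝓡 d) x)) : Prop :=
  ∀ a : M, ∃ U : Set M, IsOpen U ∧ a ∈ U ∧
    ∃ X : Fin r → (x : M) → TangentSpace (𝓡 d) x,
      (∀ i, IsSmoothFieldOn U (X i)) ∧
      ∀ x ∈ U, LinearIndependent ℝ (fun i => X i x) ∧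
        Submodule.span ℝ (Set.range fun i => X i x) = D x

/-- `X` is, on `U`, a smooth section of the distribution `D`. -/
def IsSectionOn (D : (x : M) → Submodule ℝ (TangentSpace (𝓡 d) x)) (U : Set M)
    (X : (x : M) → TangentSpace (𝓡 d) x) : Prop :=
  IsSmoothFieldOn U X ∧ ∀ x ∈ U, X x ∈ D x

/-- `X` is, on the open set `U`, a Cauchy characteristic vector field of the distribution `D`:
a section of `D` whose Lie bracket with every local section of `D` is again a section of `D`. -/
def IsCauchyCharacteristicOn (D : (x : M) → Submodule ℝ (TangentSpace (𝓡 d) x)) (U : Set M)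
    (X : (x : M) → TangentSpace (𝓡 d) x) : Prop :=
  IsSectionOn D U X ∧
    ∀ V : Set M, IsOpen V → V ⊆ U → ∀ Y : (x : M) → TangentSpace (𝓡 d) x,
      IsSectionOn D V Y → ∀ x ∈ V, VectorField.mlieBracket (𝓡 d) X Y x ∈ D x

/-- The distribution `P` consists of Cauchy characteristics of `D`: all local sections of `P` are
Cauchy characteristic vector fields of `D`. -/
def ConsistsOfCauchyCharacteristics
    (P D : (x : M) → Submodule ℝ (TangentSpace (𝓡 d) x)) : Prop :=
  ∀ U : Set M, IsOpen U → ∀ X : (x : M) → TangentSpace (𝓡 d) x,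
    IsSectionOn P U X → IsCauchyCharacteristicOn D U X

end Distributions

/-! ### Systems of PDEs as submanifolds `ι : E → J^k(ℝⁿ, ℝᵐ)` -/

section Systems

variable {n m k d : ℕ} {E : Type*} [TopologicalSpace E]
  [ChartedSpace (EuclideanSpace ℝ (Fin d)) E]

/-- The differential of the inclusion, `T_a E → T_{ι a} J^k = J^k`. -/
def dInclusion (ι : E → JetSpace n m k) (a : E) :
    TangentSpace (𝓡 d) a →ₗ[ℝ] JetSpace n m k :=
  (mfderiv (𝓡 d) 𝓘(ℝ, JetSpace n m k) ι a).toLinearMap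

/-- The differential of `π_k` restricted to the equation, `dπ_k : T_a E → T W = ℝⁿ`. -/
def dBase (ι : E → JetSpace n m k) (a : E) : TangentSpace (𝓡 d) a →ₗ[ℝ] (Fin n → ℝ) :=
  (mfderiv (𝓡 d) 𝓘(ℝ, Fin n → ℝ) (fun b => (ι b).1) a).toLinearMap

/-- The induced Cartan distribution `C_E = C ∩ TE`. -/
def inducedCartan (ι : E → JetSpace n m k) (a : E) : Submodule ℝ (TangentSpace (𝓡 d) a) :=
  (cartan (ι a)).comap (dInclusion ι a)

/-- The symbol `g_k(a) = Ker(dπ_{k,k-1} : T_a E → T J^{k-1})` as a subspace of `SᵏT* ⊗ ℝᵐ`. -/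
def symbol (ι : E → JetSpace n m k) (a : E) : Submodule ℝ (SymTensor n m) :=
  homogeneous n m k ⊓ (LinearMap.range (dInclusion (d := d) ι a)).comap (verticalVector n m k)

/-- The first prolongation `E^{(1)} ⊆ J^{k+1}`: the `(k+1)`-jets over points of `E` whose
horizontal `n`-plane, spanned by the total derivatives, is tangent to `E`. -/
def prolongation (d : ℕ) {E : Type*} [TopologicalSpace E]
    [ChartedSpace (EuclideanSpace ℝ (Fin d)) E] (ι : E → JetSpace n m k) :
    Set (JetSpace n m (k + 1)) :=
  {θ | ∃ a : E, truncate θ = ι a ∧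
    ∀ i, totalDerivative θ i ∈ LinearMap.range (dInclusion (d := d) ι a)}

/-- The system is involutive: its symbol is involutive at every point and it is compatible, i.e.
the projection `E^{(1)} → E` is surjective. -/
def IsInvolutiveSystem (d : ℕ) {E : Type*} [TopologicalSpace E]
    [ChartedSpace (EuclideanSpace ℝ (Fin d)) E] (ι : E → JetSpace n m k) : Prop :=
  (∀ a, IsInvolutiveSymbol k (symbol (d := d) ι a)) ∧
    Set.SurjOn truncate (prolongation d ι) (Set.range ι)

/-- The system is of class `c`: at every point the dimensions of the symbol spaces
`g_k, g_{k+1}, …` stabilize at `c`. -/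
def IsOfClass (d : ℕ) {E : Type*} [TopologicalSpace E]
    [ChartedSpace (EuclideanSpace ℝ (Fin d)) E] (c : ℕ) (ι : E → JetSpace n m k) : Prop :=
  ∀ a, ∀ᶠ l in Filter.atTop,
    Module.finrank ℝ (prolongedSymbol k (symbol (d := d) ι a) l) = c

/-- The characteristic variety at `a`: the points `[p]` of the projectivized cotangent space
`ℙ T*W` with `pᵏ ⊗ v ∈ g_k(a)` for some `v ≠ 0` in `ℝᵐ`. (The condition does not depend on the
representative `p`.) -/
def characteristicVariety (d : ℕ) {E : Type*} [TopologicalSpace E]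
    [ChartedSpace (EuclideanSpace ℝ (Fin d)) E] (ι : E → JetSpace n m k) (a : E) :
    Set (Projectivization ℝ (Module.Dual ℝ (Fin n → ℝ))) :=
  {P | ∃ v : Fin m → ℝ, v ≠ 0 ∧ powTensor P.rep k v ∈ symbol (d := d) ι a}

end Systems

end JetPDE

end

/-! The argument has an algebraic half and a differential half, joined by the curvature of the
Cartan distribution.

Algebra. For large `l` both `g_{k+l}` and `g_{k+l+1}` are lines. Contracting a generator `f₁` of the
upper line gives `w ⌟ f₁ = p(w) f₀` for a real covector `p ≠ 0`. Since contractions commute, `f₀` is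
killed by `ker p`, so it is a power of `p` tensored with a vector
(`prolongedSymbol_eq_span_powTensor`). Vanishing of the top Spencer cohomology `H^{i,n}` says that
`g_i` is spanned by contractions of `g_{i+1}`, so this form descends to `g_k = ℝ pᵏ ⊗ v`
(`exists_eq_span_powTensor`). As `k ≥ 1`, the line determines `[p]`, which is the only
characteristic covector.

Geometry. A point of the first prolongation over `a` provides a horizontal `n`-plane in `T_a E`, and
the Cartan space of `E` is this plane plus the symbol line, of dimension `n + 1`. The contact forms
of a bracket of Cartan sections are given by a pointwise 2-form with values in symmetric tensors
(`contactForm_mlieBracket`). In the splitting it is, on `(w, t)` and `(w', t')`, the tensor `(t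
p(w') - t' p(w)) pᵏ⁻¹ ⊗ v`. Its radical is the horizontal lift of `ker p`, of dimension `n - 1`.

This radical is `Π`. Its sections are Cauchy characteristics by the bracket formula. Conversely, a
smooth distribution of Cauchy characteristics lies in the radical (`le_cauchyDistribution`), so
equality of ranks gives uniqueness. Smoothness of both distributions follows from writing them as
kernels of smooth linear families of constant rank (`exists_smooth_kernel_frame`). -/

noncomputable section

namespace JetPDE

/-! ### Algebra of symbols: involutive symbols of class one are lines of decomposable tensors. -/

section Symbols

variable {n m : ℕ}

theorem contract_apply (w : Fin n → ℝ) (f : SymTensor n m) (σ : Fin n → ℕ) :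
    contract n m w f σ = ∑ i, w i • f (σ + Pi.single i 1) := rfl

theorem contract_single_apply (i : Fin n) (f : SymTensor n m) (σ : Fin n → ℕ) :
    contract n m (Pi.single i 1) f σ = f (σ + Pi.single i 1) := by
  rw [contract_apply, Finset.sum_eq_single i]
  · simp
  · intro b _ hb
    simp [Pi.single_eq_of_ne hb]
  · simp

theorem contract_comm (w w' : Fin n → ℝ) (f : SymTensor n m) :
    contract n m w (contract n m w' f) = contract n m w' (contract n m w f) := by
  funext σ
  simp only [contract_apply, Finset.smul_sum]
  rw [Finset.sum_comm]
  refine Finset.sum_congr rfl fun i _ => Finset.sum_congr rfl fun j _ => ?_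
  rw [smul_comm, add_right_comm]

theorem contract_mem_homogeneous {l : ℕ} {f : SymTensor n m} (hf : f ∈ homogeneous n m (l + 1))
    (w : Fin n → ℝ) : contract n m w f ∈ homogeneous n m l := by
  intro σ hσ
  rw [contract_apply]
  refine Finset.sum_eq_zero fun i _ => ?_
  rw [hf, smul_zero]
  rw [sum_add_single]
  omega

theorem exists_eq_add_single {l : ℕ} {σ : Fin n → ℕ} (hσ : ∑ i, σ i = l + 1) :
    ∃ (τ : Fin n → ℕ) (i : Fin n), σ = τ + Pi.single i 1 := by
  obtain ⟨i, hi⟩ : ∃ i, σ i ≠ 0 := by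
    by_contra! h
    simp [h] at hσ
  refine ⟨σ - Pi.single i 1, i, ?_⟩
  funext j
  by_cases h : j = i
  · subst h
    simp
    omega
  · simp [Pi.single_eq_of_ne h]

/-- A symmetric tensor of positive degree all of whose contractions vanish is zero. -/
theorem eq_zero_of_contract_eq_zero {l : ℕ} {f : SymTensor n m}
    (hf : f ∈ homogeneous n m (l + 1)) (h : ∀ w, contract n m w f = 0) : f = 0 := by
  funext σ
  by_cases hσ : ∑ i, σ i = l + 1
  · obtain ⟨τ, i, rfl⟩ := exists_eq_add_single hσ
    rw [← contract_single_apply i f τ, h]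
    rfl
  · exact hf σ hσ

theorem powTensor_mem_homogeneous (p : Module.Dual ℝ (Fin n → ℝ)) (l : ℕ) (v : Fin m → ℝ) :
    powTensor p l v ∈ homogeneous n m l := fun _ hσ => if_neg hσ

theorem powTensor_smul (c : ℝ) (p : Module.Dual ℝ (Fin n → ℝ)) (l : ℕ) (v : Fin m → ℝ) :
    powTensor (c • p) l v = c ^ l • powTensor p l v := by
  funext σ
  rw [Pi.smul_apply]
  by_cases hσ : ∑ i, σ i = l
  · simp only [powTensor, LinearMap.smul_apply, smul_eq_mul, mul_pow,
      Finset.prod_mul_distrib, Finset.prod_pow_eq_pow_sum, hσ, if_true, smul_smul]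
  · simp only [powTensor, if_neg hσ, smul_zero]

theorem contract_powTensor (p : Module.Dual ℝ (Fin n → ℝ)) (l : ℕ) (v : Fin m → ℝ)
    (w : Fin n → ℝ) : contract n m w (powTensor p (l + 1) v) = p w • powTensor p l v := by
  funext σ
  rw [contract_apply, Pi.smul_apply]
  by_cases hσ : ∑ i, σ i = l
  · have hp : p w = ∑ i, w i * p (Pi.single i 1) := by
      conv_lhs => rw [pi_eq_sum_univ' w, map_sum]
      exact Finset.sum_congr rfl fun i _ => by rw [map_smul, smul_eq_mul]
    have key : ∀ i : Fin n, powTensor p (l + 1) v (σ + Pi.single i 1) =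
        (p (Pi.single i 1) * ∏ j, p (Pi.single j 1) ^ σ j) • v := by
      intro i
      rw [powTensor, if_pos (by rw [sum_add_single, hσ])]
      congr 1
      simp only [Pi.add_apply, pow_add, Finset.prod_mul_distrib]
      rw [mul_comm]
      congr 1
      rw [Finset.prod_eq_single i]
      · simp
      · intro b _ hb
        simp [Pi.single_eq_of_ne hb]
      · simp
    rw [Finset.sum_congr rfl fun i _ => by rw [key i], powTensor, if_pos hσ, hp, smul_smul,
      Finset.sum_mul, Finset.sum_smul]
    exact Finset.sum_congr rfl fun i _ => by rw [smul_smul, mul_assoc]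
  · rw [powTensor_mem_homogeneous p l v σ hσ, smul_zero]
    refine Finset.sum_eq_zero fun i _ => ?_
    rw [powTensor_mem_homogeneous p (l + 1) v _ (by rw [sum_add_single]; omega), smul_zero]

theorem exists_apply_eq_one {V : Type*} [AddCommGroup V] [Module ℝ V] {p : Module.Dual ℝ V}
    (hp : p ≠ 0) : ∃ w, p w = 1 := by
  obtain ⟨w, hw⟩ : ∃ w, p w ≠ 0 := by
    by_contra! h
    exact hp (LinearMap.ext h)
  exact ⟨(p w)⁻¹ • w, by simp [hw]⟩

theorem powTensor_ne_zero {p : Module.Dual ℝ (Fin n → ℝ)} (hp : p ≠ 0) {v : Fin m → ℝ}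
    (hv : v ≠ 0) (l : ℕ) : powTensor p l v ≠ 0 := by
  induction l with
  | zero =>
    intro h
    apply hv
    simpa [powTensor] using congrFun h 0
  | succ l ih =>
    obtain ⟨w, hw⟩ := exists_apply_eq_one hp
    intro h
    apply ih
    have := contract_powTensor p l v w
    rwa [h, map_zero, hw, one_smul, eq_comm] at this

/-- A symmetric tensor annihilated by all contractions with `ker p` is of the form `pˡ ⊗ v`. -/
theorem exists_eq_powTensor {p : Module.Dual ℝ (Fin n → ℝ)} (hp : p ≠ 0) {l : ℕ}
    {f : SymTensor n m} (hf : f ∈ homogeneous n m l)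
    (h : ∀ w, p w = 0 → contract n m w f = 0) : ∃ v, f = powTensor p l v := by
  induction l generalizing f with
  | zero =>
    refine ⟨f 0, funext fun σ => ?_⟩
    by_cases hσ : ∑ i, σ i = 0
    · have h0 : σ = 0 := funext fun i => by simpa using (Finset.sum_eq_zero_iff.mp hσ) i
      subst h0
      simp [powTensor]
    · rw [hf σ hσ, powTensor, if_neg hσ]
  | succ l ih =>
    obtain ⟨u, hu⟩ := exists_apply_eq_one hp
    obtain ⟨v, hv⟩ := ih (contract_mem_homogeneous hf u)
      (fun w hw => by rw [contract_comm, h w hw, map_zero])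
    refine ⟨v, sub_eq_zero.mp (eq_zero_of_contract_eq_zero
      (Submodule.sub_mem _ hf (powTensor_mem_homogeneous p _ v)) fun w => ?_)⟩
    -- Since `p u = 1`, any `w` is `p w • u` plus a vector of `ker p`; hence the contractions of `f`
    -- are determined by the one with `u`.
    have hw : contract n m (w - p w • u) f = 0 := h _ (by simp [hu])
    rw [map_sub, LinearMap.sub_apply, map_smul, LinearMap.smul_apply, hv] at hw
    rw [map_sub, contract_powTensor, hw]

theorem mem_prolongedSymbol_succ {k : ℕ} {g : Submodule ℝ (SymTensor n m)} {l : ℕ}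
    {f : SymTensor n m} : f ∈ prolongedSymbol k g (l + 1) ↔
      f ∈ homogeneous n m (k + l + 1) ∧ ∀ w, contract n m w f ∈ prolongedSymbol k g l := by
  simp [prolongedSymbol]

theorem prolongedSymbol_le_homogeneous {k : ℕ} {g : Submodule ℝ (SymTensor n m)}
    (hg : g ≤ homogeneous n m k) (l : ℕ) : prolongedSymbol k g l ≤ homogeneous n m (k + l) := by
  cases l with
  | zero => exact hg
  | succ l => exact inf_le_left

/-- If two consecutive symbol spaces are lines, then the first of them is spanned by a real
decomposable tensor. -/
theorem prolongedSymbol_eq_span_powTensor {k : ℕ} {g : Submodule ℝ (SymTensor n m)}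
    (hg : g ≤ homogeneous n m k) {l : ℕ}
    (h₀ : Module.finrank ℝ (prolongedSymbol k g l) = 1)
    (h₁ : Module.finrank ℝ (prolongedSymbol k g (l + 1)) = 1) :
    ∃ (p : Module.Dual ℝ (Fin n → ℝ)) (v : Fin m → ℝ), p ≠ 0 ∧ v ≠ 0 ∧
      prolongedSymbol k g l = ℝ ∙ powTensor p (k + l) v := by
  obtain ⟨⟨f₀, hf₀⟩, hne₀, hs₀⟩ := finrank_eq_one_iff'.mp h₀
  obtain ⟨⟨f₁, hf₁⟩, hne₁, -⟩ := finrank_eq_one_iff'.mp h₁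
  have hne₀' : f₀ ≠ 0 := fun h => hne₀ (Subtype.ext h)
  have hne₁' : f₁ ≠ 0 := fun h => hne₁ (Subtype.ext h)
  have hspan : prolongedSymbol k g l = ℝ ∙ f₀ := by
    refine le_antisymm (fun f hf => ?_) ((Submodule.span_singleton_le_iff_mem _ _).mpr hf₀)
    obtain ⟨c, hc⟩ := hs₀ ⟨f, hf⟩
    exact Submodule.mem_span_singleton.mpr ⟨c, congrArg Subtype.val hc⟩
  obtain ⟨hhom, hcon⟩ := mem_prolongedSymbol_succ.mp hf₁
  let e : ℝ ≃ₗ[ℝ] (ℝ ∙ f₀) := LinearEquiv.toSpanNonzeroSingleton ℝ _ f₀ hne₀'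
  -- `p w` is the coordinate of `w ⌟ f₁` on the line through `f₀`.
  let p : Module.Dual ℝ (Fin n → ℝ) := e.symm.toLinearMap ∘ₗ
    LinearMap.codRestrict (ℝ ∙ f₀) ((contract n m).flip f₁) (fun w => hspan ▸ hcon w)
  have hp : ∀ w, contract n m w f₁ = p w • f₀ := by
    intro w
    have : e (p w) = ⟨contract n m w f₁, hspan ▸ hcon w⟩ := e.apply_symm_apply _
    exact (congrArg Subtype.val this).symm
  have hp0 : p ≠ 0 := by
    intro h
    exact hne₁' (eq_zero_of_contract_eq_zero hhom fun w => by rw [hp, h]; simp)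
  obtain ⟨u, hu⟩ := exists_apply_eq_one hp0
  -- With `f₀ = u ⌟ f₁` and `w ∈ ker p`, commuting the contractions gives `w ⌟ f₀ = u ⌟ (w ⌟ f₁) =
  -- 0`.
  obtain ⟨v, hv⟩ := exists_eq_powTensor hp0 (prolongedSymbol_le_homogeneous hg l hf₀)
    (fun w hw => by
      have := contract_comm w u f₁
      rwa [hp, hp, hu, hw, one_smul, zero_smul, map_zero] at this)
  refine ⟨p, v, hp0, ?_, hv ▸ hspan⟩
  rintro rfl
  apply hne₀'
  rw [hv]
  funext σ
  simp [powTensor]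

theorem alternatingMap_eq_zero_of_lt {N : Type*} [AddCommGroup N] [Module ℝ N]
    {j : ℕ} (hj : n < j) (α : (Fin n → ℝ) [⋀^Fin j]→ₗ[ℝ] N)
    [Module.IsTorsionFree ℝ N] : α = 0 := by
  ext v
  refine α.map_linearDependent v fun h => ?_
  have := h.fintype_card_le_finrank
  simp at this
  omega

/-- Exactness of the Spencer complex at `g_i ⊗ ΛⁿT*` propagates decomposability downwards. -/
theorem prolongedSymbol_eq_span_powTensor_of_succ {k : ℕ} {g : Submodule ℝ (SymTensor n m)}
    (hinv : IsInvolutiveSymbol k g) {p : Module.Dual ℝ (Fin n → ℝ)} (hp : p ≠ 0)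
    {v : Fin m → ℝ} {l : ℕ}
    (h : prolongedSymbol k g (l + 1) = ℝ ∙ powTensor p (k + l + 1) v) :
    prolongedSymbol k g l = ℝ ∙ powTensor p (k + l) v := by
  have hcon : ∀ (w : Fin n → ℝ), ∀ f ∈ prolongedSymbol k g (l + 1),
      contract n m w f ∈ ℝ ∙ powTensor p (k + l) v := by
    intro w f hf
    rw [h, Submodule.mem_span_singleton] at hf
    obtain ⟨c, rfl⟩ := hf
    rw [map_smul, contract_powTensor]
    exact Submodule.smul_mem _ _ (Submodule.smul_mem _ _ (Submodule.mem_span_singleton_self _))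
  refine le_antisymm (fun f hf => ?_) ?_
  · obtain ⟨j, rfl⟩ : ∃ j, n = j + 1 := by
      refine Nat.exists_eq_succ_of_ne_zero ?_
      rintro rfl
      exact hp (Subsingleton.elim _ _)
    -- `α = f ⊗ vol` has top degree `n = j + 1`, so it is automatically a cocycle. A primitive `η`
    -- then writes `f = α(e₁, …, eₙ)` as a signed sum of contractions of elements of the next symbol
    -- space.
    let α : (Fin (j + 1) → ℝ) [⋀^Fin (j + 1)]→ₗ[ℝ] SymTensor (j + 1) m :=
      (LinearMap.toSpanSingleton ℝ _ f).compAlternatingMap (Pi.basisFun ℝ (Fin (j + 1))).det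
    obtain ⟨η, hη, hηα⟩ := hinv l j α (fun w => Submodule.smul_mem _ _ hf)
      (alternatingMap_eq_zero_of_lt (Nat.lt_succ_self _) _)
    have hf' : f = α (Pi.basisFun ℝ (Fin (j + 1))) := by
      simp only [α, LinearMap.compAlternatingMap_apply, Module.Basis.det_self,
        LinearMap.toSpanSingleton_apply, one_smul]
    rw [hf', ← hηα, spencer, AlternatingMap.alternatizeUncurryFin_apply]
    refine Submodule.sum_mem _ fun s _ => ?_
    rw [← Int.cast_smul_eq_zsmul ℝ]
    exact Submodule.smul_mem _ _ (hcon _ _ (hη _))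
  · rw [Submodule.span_singleton_le_iff_mem]
    obtain ⟨u, hu⟩ := exists_apply_eq_one hp
    have h1 : powTensor p (k + l + 1) v ∈ prolongedSymbol k g (l + 1) :=
      h ▸ Submodule.mem_span_singleton_self _
    have := (mem_prolongedSymbol_succ.mp h1).2 u
    rwa [contract_powTensor, hu, one_smul] at this

/-- An involutive symbol of class `1` is spanned by a real decomposable tensor. -/
theorem exists_eq_span_powTensor {k : ℕ} {g : Submodule ℝ (SymTensor n m)}
    (hg : g ≤ homogeneous n m k) (hinv : IsInvolutiveSymbol k g)
    (hclass : ∀ᶠ l in Filter.atTop, Module.finrank ℝ (prolongedSymbol k g l) = 1) :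
    ∃ (p : Module.Dual ℝ (Fin n → ℝ)) (v : Fin m → ℝ), p ≠ 0 ∧ v ≠ 0 ∧
      g = ℝ ∙ powTensor p k v := by
  obtain ⟨l, hl⟩ := Filter.eventually_atTop.mp hclass
  obtain ⟨p, v, hp, hv, h⟩ :=
    prolongedSymbol_eq_span_powTensor hg (hl l le_rfl) (hl (l + 1) (Nat.le_succ l))
  refine ⟨p, v, hp, hv, ?_⟩
  have : ∀ i, prolongedSymbol k g i = ℝ ∙ powTensor p (k + i) v →
      prolongedSymbol k g 0 = ℝ ∙ powTensor p (k + 0) v := by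
    intro i
    induction i with
    | zero => exact id
    | succ i ih => exact fun h => ih (prolongedSymbol_eq_span_powTensor_of_succ hinv hp h)
  exact this l h

/-- The covector of a nonzero decomposable tensor of positive degree is determined up to scale. -/
theorem eq_smul_of_powTensor_mem_span {p q : Module.Dual ℝ (Fin n → ℝ)} {v v' : Fin m → ℝ}
    {l : ℕ} (hp : p ≠ 0) (hq : q ≠ 0) (hv' : v' ≠ 0)
    (h : powTensor q (l + 1) v' ∈ ℝ ∙ powTensor p (l + 1) v) : ∃ c : ℝ, q = c • p := by
  obtain ⟨c, hc⟩ := Submodule.mem_span_singleton.mp h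
  obtain ⟨u, hu⟩ := exists_apply_eq_one hp
  refine ⟨q u, LinearMap.ext fun w => ?_⟩
  -- A vector of `ker p` kills the `p`-tensor, hence also the `q`-tensor; so `ker p ⊆ ker q`.
  have hw := congrArg (contract n m (w - p w • u)) hc
  rw [map_smul, contract_powTensor, contract_powTensor] at hw
  simp only [map_sub, map_smul, hu, smul_eq_mul, mul_one, sub_self, zero_smul, smul_zero] at hw
  have := (smul_eq_zero.mp hw.symm).resolve_right (powTensor_ne_zero hq hv' l)
  rw [LinearMap.smul_apply, smul_eq_mul]
  linarith

end Symbols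

/-! ### Pointwise structure of the induced Cartan space and its curvature. -/

section PointwiseCurvature

variable {n m k : ℕ}

/-- The curvature of the Cartan distribution: the two-form `∑ duʲ_{σ+1_i} ∧ dxⁱ` (`|σ| < k`). -/
def curvature {n m k : ℕ} (σ : Fin n → ℕ) (hσ : ∑ l, σ l < k) (j : Fin m) :
    JetSpace n m k →ₗ[ℝ] JetSpace n m k →ₗ[ℝ] ℝ :=
  LinearMap.mk₂ ℝ
    (fun X Y => ∑ i, (X.2 (raise σ hσ i) j * Y.1 i - Y.2 (raise σ hσ i) j * X.1 i))
    (fun X X' Y => by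
      rw [← Finset.sum_add_distrib]
      exact Finset.sum_congr rfl fun i _ => by
        simp only [Prod.fst_add, Prod.snd_add, Pi.add_apply]; ring)
    (fun c X Y => by
      rw [smul_eq_mul, Finset.mul_sum]
      exact Finset.sum_congr rfl fun i _ => by
        simp only [Prod.smul_fst, Prod.smul_snd, Pi.smul_apply, smul_eq_mul]; ring)
    (fun X Y Y' => by
      rw [← Finset.sum_add_distrib]
      exact Finset.sum_congr rfl fun i _ => by
        simp only [Prod.fst_add, Prod.snd_add, Pi.add_apply]; ring)
    (fun c X Y => by
      rw [smul_eq_mul, Finset.mul_sum]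
      exact Finset.sum_congr rfl fun i _ => by
        simp only [Prod.smul_fst, Prod.smul_snd, Pi.smul_apply, smul_eq_mul]; ring)

theorem curvature_apply (σ : Fin n → ℕ) (hσ : ∑ l, σ l < k) (j : Fin m)
    (X Y : JetSpace n m k) : curvature σ hσ j X Y =
      ∑ i, (X.2 (raise σ hσ i) j * Y.1 i - Y.2 (raise σ hσ i) j * X.1 i) := rfl

theorem mem_cartan {a v : JetSpace n m k} :
    v ∈ cartan a ↔ ∀ σ (hσ : ∑ l, σ l < k) j, contactForm a σ hσ j v = 0 := by
  simp [cartan]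

theorem contactForm_apply (a : JetSpace n m k) (σ : Fin n → ℕ) (hσ : ∑ l, σ l < k) (j : Fin m)
    (v : JetSpace n m k) : contactForm a σ hσ j v =
      v.2 ⟨σ, hσ.le⟩ j - ∑ i, a.2 (raise σ hσ i) j * v.1 i := rfl

/-- The horizontal vector `∑ wⁱ D_{xⁱ}`. -/
def horizontalVector (θ : JetSpace n m (k + 1)) : (Fin n → ℝ) →ₗ[ℝ] JetSpace n m k :=
  Fintype.linearCombination ℝ (totalDerivative θ)

theorem horizontalVector_fst (θ : JetSpace n m (k + 1)) (w : Fin n → ℝ) :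
    (horizontalVector θ w).1 = w := by
  rw [horizontalVector, Fintype.linearCombination_apply, Prod.fst_sum]
  exact (pi_eq_sum_univ' w).symm

theorem horizontalVector_snd (θ : JetSpace n m (k + 1)) (w : Fin n → ℝ) (σ : MultiIndex n k)
    (j : Fin m) : (horizontalVector θ w).2 σ j =
      ∑ i, θ.2 (raise σ.1 (Nat.lt_succ_of_le σ.2) i) j * w i := by
  rw [horizontalVector, Fintype.linearCombination_apply, Prod.snd_sum, Finset.sum_apply,
    Finset.sum_apply]
  exact Finset.sum_congr rfl fun i _ => mul_comm _ _

theorem horizontalVector_mem_cartan (θ : JetSpace n m (k + 1)) (w : Fin n → ℝ) :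
    horizontalVector θ w ∈ cartan (truncate θ) := by
  rw [mem_cartan]
  intro σ hσ j
  rw [contactForm_apply, horizontalVector_snd, horizontalVector_fst, sub_eq_zero]
  rfl

theorem verticalVector_mem_cartan (a : JetSpace n m k) {f : SymTensor n m}
    (hf : f ∈ homogeneous n m k) : verticalVector n m k f ∈ cartan a := by
  rw [mem_cartan]
  intro σ hσ j
  rw [contactForm_apply]
  simp [verticalVector, hf σ hσ.ne]

/-- A vertical vector of the Cartan distribution is given by a homogeneous tensor. -/
theorem exists_eq_verticalVector {a v : JetSpace n m k} (hv : v ∈ cartan a) (h : v.1 = 0) :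
    ∃ f ∈ homogeneous n m k, verticalVector n m k f = v := by
  classical
  rw [mem_cartan] at hv
  refine ⟨fun σ => if hσ : ∑ i, σ i = k then v.2 ⟨σ, hσ.le⟩ else 0, fun σ hσ => dif_neg hσ,
    Prod.ext h.symm (funext fun σ => ?_)⟩
  by_cases hσ : ∑ i, σ.1 i = k
  · exact dif_pos hσ
  · refine (dif_neg hσ).trans (funext fun j => ?_)
    have := hv σ.1 (lt_of_le_of_ne σ.2 hσ) j
    rw [contactForm_apply, h] at this
    simpa using this.symm

/-- The coefficients `u_{σ+1_i+1_l}` are symmetric in `i` and `l`: a single `(k+1)`-jet defines an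
integral element. -/
theorem curvature_horizontal_horizontal (θ : JetSpace n m (k + 1)) (w w' : Fin n → ℝ)
    (σ : Fin n → ℕ) (hσ : ∑ l, σ l < k) (j : Fin m) :
    curvature σ hσ j (horizontalVector θ w) (horizontalVector θ w') = 0 := by
  simp only [curvature_apply, horizontalVector_fst, horizontalVector_snd, Finset.sum_mul,
    Finset.sum_sub_distrib]
  rw [sub_eq_zero, Finset.sum_comm]
  refine Finset.sum_congr rfl fun i _ => Finset.sum_congr rfl fun l _ => ?_
  have e : raise (raise σ hσ i).1 (Nat.lt_succ_of_le (raise σ hσ i).2) l =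
      raise (raise σ hσ l).1 (Nat.lt_succ_of_le (raise σ hσ l).2) i :=
    Subtype.ext (add_right_comm _ _ _)
  rw [mul_right_comm, e]

/-- This mixed term is the only nonzero block of the curvature; it is how the symbol controls the
bracket. -/
theorem curvature_horizontal_vertical (θ : JetSpace n m (k + 1)) (w : Fin n → ℝ)
    (f : SymTensor n m) (σ : Fin n → ℕ) (hσ : ∑ l, σ l < k) (j : Fin m) :
    curvature σ hσ j (horizontalVector θ w) (verticalVector n m k f) =
      - contract n m w f σ j := by
  rw [curvature_apply, horizontalVector_fst, contract_apply, Finset.sum_apply,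
    ← Finset.sum_neg_distrib]
  refine Finset.sum_congr rfl fun i _ => ?_
  simp [verticalVector, raise, mul_comm]

theorem curvature_vertical_vertical (f f' : SymTensor n m) (σ : Fin n → ℕ)
    (hσ : ∑ l, σ l < k) (j : Fin m) :
    curvature σ hσ j (verticalVector n m k f) (verticalVector n m k f') = 0 := by
  rw [curvature_apply]
  exact Finset.sum_eq_zero fun i _ => by simp [verticalVector]

theorem curvature_swap (σ : Fin n → ℕ) (hσ : ∑ l, σ l < k) (j : Fin m)
    (X Y : JetSpace n m k) : curvature σ hσ j X Y = - curvature σ hσ j Y X := by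
  rw [curvature_apply, curvature_apply, ← Finset.sum_neg_distrib]
  exact Finset.sum_congr rfl fun i _ => by ring

variable {V : Type*} [AddCommGroup V] [Module ℝ V]

/-- The radical of the curvature on a subspace `C` of a space `V` mapped to `T J^k` by `D`. -/
def curvatureRadical (D : V →ₗ[ℝ] JetSpace n m k) (C : Submodule ℝ V) : Submodule ℝ V where
  carrier := {x | x ∈ C ∧ ∀ y ∈ C, ∀ σ (hσ : ∑ l, σ l < k) j, curvature σ hσ j (D x) (D y) = 0}
  add_mem' {x x'} hx hx' := ⟨C.add_mem hx.1 hx'.1, fun y hy σ hσ j => by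
    rw [map_add, map_add, LinearMap.add_apply, hx.2 y hy, hx'.2 y hy, add_zero]⟩
  zero_mem' := ⟨C.zero_mem, fun y _ σ hσ j => by rw [map_zero, map_zero, LinearMap.zero_apply]⟩
  smul_mem' c x hx := ⟨C.smul_mem c hx.1, fun y hy σ hσ j => by
    rw [map_smul, map_smul, LinearMap.smul_apply, hx.2 y hy, smul_zero]⟩

/-- The splitting of the induced Cartan space into a horizontal plane and a symbol line. -/
theorem exists_parametrization {D : V →ₗ[ℝ] JetSpace n m k} (hD : Function.Injective D)
    (θ : JetSpace n m (k + 1)) (hθ : ∀ i, totalDerivative θ i ∈ LinearMap.range D)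
    {f : SymTensor n m} (hf : f ≠ 0)
    (hsym : homogeneous n m k ⊓ (LinearMap.range D).comap (verticalVector n m k) = ℝ ∙ f) :
    ∃ Ψ : ((Fin n → ℝ) × ℝ) →ₗ[ℝ] V, Function.Injective Ψ ∧
      LinearMap.range Ψ = (cartan (truncate θ)).comap D ∧
      ∀ w t, D (Ψ (w, t)) = horizontalVector θ w + t • verticalVector n m k f := by
  obtain ⟨hfh, e, he⟩ : f ∈ homogeneous n m k ⊓
      (LinearMap.range D).comap (verticalVector n m k) :=
    hsym ▸ Submodule.mem_span_singleton_self f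
  choose h hh using hθ
  let Ψ : ((Fin n → ℝ) × ℝ) →ₗ[ℝ] V :=
    (Fintype.linearCombination ℝ h).coprod (LinearMap.toSpanSingleton ℝ V e)
  have hΨ : ∀ w t, D (Ψ (w, t)) = horizontalVector θ w + t • verticalVector n m k f := by
    intro w t
    simp [Ψ, horizontalVector, Fintype.linearCombination_apply, hh, he]
  have hfst : ∀ w t, (D (Ψ (w, t))).1 = w := by
    intro w t
    rw [hΨ, Prod.fst_add, horizontalVector_fst]
    simp [verticalVector]
  refine ⟨Ψ, ?_, le_antisymm ?_ fun x hx => ?_, hΨ⟩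
  · rw [← LinearMap.ker_eq_bot, Submodule.eq_bot_iff]
    rintro ⟨w, t⟩ hwt
    rw [LinearMap.mem_ker] at hwt
    have hw : w = 0 := by rw [← hfst w t, hwt, map_zero]; rfl
    subst hw
    have h2 := hΨ 0 t
    rw [hwt, map_zero, map_zero, zero_add, eq_comm, smul_eq_zero] at h2
    refine Prod.ext rfl (h2.resolve_right fun h0 => hf (funext fun σ => ?_))
    by_cases hσ : ∑ i, σ i = k
    · exact congrFun (congrArg Prod.snd h0) ⟨σ, hσ.le⟩
    · exact hfh σ hσ
  · rintro _ ⟨⟨w, t⟩, rfl⟩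
    rw [Submodule.mem_comap, hΨ]
    exact Submodule.add_mem _ (horizontalVector_mem_cartan θ w)
      (Submodule.smul_mem _ _ (verticalVector_mem_cartan _ hfh))
  -- Subtracting the horizontal vector over the same base vector leaves a vertical Cartan vector
  -- tangent to the equation, that is, an element of the symbol.
  · have hmem : D x - D (Ψ ((D x).1, 0)) ∈ cartan (truncate θ) := by
      refine Submodule.sub_mem _ hx ?_
      rw [hΨ, zero_smul, add_zero]
      exact horizontalVector_mem_cartan θ _
    obtain ⟨f', hf', hf'v⟩ := exists_eq_verticalVector hmem
      (by rw [Prod.fst_sub, hfst, sub_self])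
    have : f' ∈ ℝ ∙ f := by
      rw [← hsym]
      exact ⟨hf', x - Ψ ((D x).1, 0), by rw [map_sub, hf'v]⟩
    obtain ⟨c, rfl⟩ := Submodule.mem_span_singleton.mp this
    refine ⟨((D x).1, c), hD ?_⟩
    rw [map_smul, hΨ, zero_smul, add_zero] at hf'v
    rw [hΨ, hf'v, add_sub_cancel]

theorem finrank_comap_cartan {D : V →ₗ[ℝ] JetSpace n m k} (hD : Function.Injective D)
    (θ : JetSpace n m (k + 1)) (hθ : ∀ i, totalDerivative θ i ∈ LinearMap.range D)
    {f : SymTensor n m} (hf : f ≠ 0)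
    (hsym : homogeneous n m k ⊓ (LinearMap.range D).comap (verticalVector n m k) = ℝ ∙ f) :
    Module.finrank ℝ ((cartan (truncate θ)).comap D) = n + 1 := by
  obtain ⟨Ψ, hinj, hr, -⟩ := exists_parametrization hD θ hθ hf hsym
  rw [← hr, LinearMap.finrank_range_of_inj hinj]
  simp

/-- For a symbol spanned by `pᵏ ⊗ v`, the radical of the curvature is parametrized by `ker p`. -/
theorem exists_parametrization_curvatureRadical (hk : 1 ≤ k) {D : V →ₗ[ℝ] JetSpace n m k}
    (hD : Function.Injective D) (θ : JetSpace n m (k + 1))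
    (hθ : ∀ i, totalDerivative θ i ∈ LinearMap.range D)
    {p : Module.Dual ℝ (Fin n → ℝ)} (hp : p ≠ 0) {v : Fin m → ℝ} (hv : v ≠ 0)
    (hsym : homogeneous n m k ⊓ (LinearMap.range D).comap (verticalVector n m k) =
      ℝ ∙ powTensor p k v) :
    ∃ T : LinearMap.ker p →ₗ[ℝ] V, Function.Injective T ∧
      LinearMap.range T = curvatureRadical D ((cartan (truncate θ)).comap D) ∧
      ∀ w, (D (T w)).1 = w := by
  obtain ⟨l, rfl⟩ : ∃ l, k = l + 1 := Nat.exists_eq_succ_of_ne_zero (by omega)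
  obtain ⟨Ψ, hinj, hr, hΨ⟩ :=
    exists_parametrization hD θ hθ (powTensor_ne_zero hp hv (l + 1)) hsym
  have hcurv : ∀ w t w' t' σ (hσ : ∑ i, σ i < l + 1) j,
      curvature σ hσ j (D (Ψ (w, t))) (D (Ψ (w', t'))) =
        (t * p w' - t' * p w) * powTensor p l v σ j := by
    intro w t w' t' σ hσ j
    simp only [hΨ, map_add, LinearMap.add_apply, map_smul, LinearMap.smul_apply,
      curvature_horizontal_horizontal, curvature_vertical_vertical,
      curvature_horizontal_vertical]
    rw [curvature_swap, curvature_horizontal_vertical, contract_powTensor, contract_powTensor]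
    simp only [Pi.smul_apply, smul_eq_mul]
    ring
  -- The common factor `pᵏ⁻¹ ⊗ v` is nonzero, so a single component of the curvature suffices to
  -- detect the scalar factor.
  obtain ⟨σ, hσ, j, hne⟩ : ∃ σ, ∑ i, σ i < l + 1 ∧ ∃ j, powTensor p l v σ j ≠ 0 := by
    obtain ⟨σ, hσ⟩ := Function.ne_iff.mp (powTensor_ne_zero hp hv l)
    obtain ⟨j, hj⟩ := Function.ne_iff.mp hσ
    refine ⟨σ, ?_, j, hj⟩
    by_contra h
    exact hσ (powTensor_mem_homogeneous p l v σ (by omega))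
  refine ⟨Ψ ∘ₗ LinearMap.inl ℝ _ _ ∘ₗ (LinearMap.ker p).subtype, ?_, le_antisymm ?_ ?_, ?_⟩
  · exact hinj.comp (LinearMap.inl_injective.comp (LinearMap.ker p).injective_subtype)
  · rintro _ ⟨w, rfl⟩
    refine ⟨hr ▸ ⟨_, rfl⟩, fun y hy σ hσ j => ?_⟩
    rw [← hr] at hy
    obtain ⟨⟨w', t'⟩, rfl⟩ := hy
    have hw : p w = 0 := w.2
    simpa [hw] using hcurv w 0 w' t' σ hσ j
  · rintro x ⟨hx, hrad⟩
    rw [← hr] at hx hrad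
    obtain ⟨⟨w, t⟩, rfl⟩ := hx
    obtain ⟨u, hu⟩ := exists_apply_eq_one hp
    -- Pairing with the horizontal `u`, where `p u = 1`, isolates `t`; pairing with the symbol
    -- generator isolates `p w`.
    have h1 := hrad _ ⟨(u, 0), rfl⟩ σ hσ j
    have h2 := hrad _ ⟨(0, 1), rfl⟩ σ hσ j
    rw [hcurv, mul_eq_zero] at h1 h2
    have ht : t = 0 := by simpa [hu] using h1.resolve_right hne
    have hw : p w = 0 := by simpa using h2.resolve_right hne
    subst ht
    exact ⟨⟨w, hw⟩, rfl⟩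
  · intro w
    change (D (Ψ ((w : Fin n → ℝ), 0))).1 = w
    rw [hΨ, zero_smul, add_zero, horizontalVector_fst]

end PointwiseCurvature

/-! ### Smooth local frames for kernels of constant rank. -/

section ConstantRank

open Filter Topology

variable {B F G : Type*} [NormedAddCommGroup B] [NormedSpace ℝ B]
  [NormedAddCommGroup F] [NormedSpace ℝ F] [FiniteDimensional ℝ F]
  [NormedAddCommGroup G] [NormedSpace ℝ G] [FiniteDimensional ℝ G]

/-- A linear map between vector spaces has a generalized inverse. -/
theorem exists_generalizedInverse {F G : Type*} [AddCommGroup F] [Module ℝ F] [AddCommGroup G]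
    [Module ℝ G] (A : F →ₗ[ℝ] G) : ∃ S : G →ₗ[ℝ] F, ∀ u, A (S (A u)) = A u := by
  obtain ⟨S₁, hS₁⟩ := A.rangeRestrict.exists_rightInverse_of_surjective A.range_rangeRestrict
  obtain ⟨S, hS⟩ := S₁.exists_extend
  refine ⟨S, fun u => ?_⟩
  have h1 : S (A u) = S₁ (A.rangeRestrict u) := LinearMap.congr_fun hS (A.rangeRestrict u)
  rw [h1]
  exact congrArg Subtype.val (LinearMap.congr_fun hS₁ (A.rangeRestrict u))

/-- The kernels of a smooth family of linear maps of constant rank have smooth local frames. -/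
theorem exists_smooth_kernel_frame {U : Set B} (hU : IsOpen U) {A : B → F →L[ℝ] G}
    (hA : ContDiffOn ℝ ∞ A U) {r : ℕ}
    (hr : ∀ y ∈ U, Module.finrank ℝ (LinearMap.ker (A y).toLinearMap) = r)
    {y₀ : B} (hy₀ : y₀ ∈ U) :
    ∃ U' ⊆ U, IsOpen U' ∧ y₀ ∈ U' ∧ ∃ Z : Fin r → B → F,
      (∀ i, ContDiffOn ℝ ∞ (Z i) U') ∧
      ∀ y ∈ U', LinearIndependent ℝ (fun i => Z i y) ∧
        Submodule.span ℝ (Set.range fun i => Z i y) = LinearMap.ker (A y).toLinearMap := by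
  obtain ⟨S, hS⟩ := exists_generalizedInverse (A y₀).toLinearMap
  have : CompleteSpace F := FiniteDimensional.complete ℝ F
  let S' : G →L[ℝ] F := LinearMap.toContinuousLinearMap S
  -- `T y₀ = 1`, so `T y` is invertible near `y₀`. On `ker (A y)` it acts as `1 - S (A y₀)`, which
  -- lands in `ker (A y₀)` because `A y₀ ∘ S ∘ A y₀ = A y₀`. Constant rank makes this onto, and the
  -- inverse of `T y` transports a fixed basis of `ker (A y₀)`.
  let T : B → F →L[ℝ] F := fun y => 1 - S'.comp (A y₀) + S'.comp (A y)
  have hT₀ : T y₀ = 1 := by simp [T]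
  have hT : ContDiffOn ℝ ∞ T U := contDiffOn_const.add (contDiffOn_const.clm_comp hA)
  let U' : Set B := U ∩ T ⁻¹' {x | IsUnit x}
  have hU' : IsOpen U' := hT.continuousOn.isOpen_inter_preimage hU Units.isOpen
  let K := LinearMap.ker (A y₀).toLinearMap
  let b : Module.Basis (Fin r) ℝ K := Module.finBasisOfFinrankEq ℝ K (hr y₀ hy₀)
  refine ⟨U', Set.inter_subset_left, hU', ⟨hy₀, by simp [hT₀]⟩,
    fun i y => Ring.inverse (T y) (b i), fun i => ?_, fun y hy => ?_⟩
  · refine ContDiffOn.clm_apply (fun y hy => ?_) contDiffOn_const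
    obtain ⟨x, hx⟩ := hy.2
    have h1 : ContDiffAt ℝ ∞ Ring.inverse (T y) := hx ▸ contDiffAt_ringInverse ℝ x
    exact (h1.comp y (hT.contDiffAt (hU.mem_nhds hy.1))).contDiffWithinAt
  · obtain ⟨x, hx⟩ := hy.2
    have hinv : Ring.inverse (T y) = (↑x⁻¹ : F →L[ℝ] F) := by rw [← hx, Ring.inverse_unit]
    have hl : ∀ u, (↑x⁻¹ : F →L[ℝ] F) (T y u) = u := fun u => by
      rw [← hx, ← mul_apply_eq_comp, x.inv_mul]; rfl
    have hri : ∀ u, T y ((↑x⁻¹ : F →L[ℝ] F) u) = u := fun u => by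
      rw [← hx, ← mul_apply_eq_comp, x.mul_inv]; rfl
    have hinj : Function.Injective (↑x⁻¹ : F →L[ℝ] F) := Function.LeftInverse.injective hri
    have hTinj : Function.Injective (T y) := Function.LeftInverse.injective hl
    simp only [hinv]
    have hmap : (LinearMap.ker (A y).toLinearMap).map (T y).toLinearMap = K := by
      refine Submodule.eq_of_le_of_finrank_eq ?_ ?_
      · rintro _ ⟨u, hu, rfl⟩
        have hu' : A y u = 0 := hu
        have : A y₀ (S (A y₀ u)) = A y₀ u := hS u
        simp [K, T, S', hu', this]
      · rw [(Submodule.equivMapOfInjective _ hTinj _).symm.finrank_eq, hr y hy.1, hr y₀ hy₀]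
    have hli : LinearIndependent ℝ (fun i => (b i : F)) :=
      b.linearIndependent.map' K.subtype (Submodule.ker_subtype K)
    refine ⟨hli.map' (↑x⁻¹ : F →L[ℝ] F).toLinearMap (LinearMap.ker_eq_bot.mpr hinj), ?_⟩
    have hspan : Submodule.span ℝ (Set.range fun i => (b i : F)) = K := by
      have := congrArg (Submodule.map K.subtype) b.span_eq
      rwa [Submodule.map_span, ← Set.range_comp, Submodule.map_subtype_top] at this
    have h2 : Set.range (fun i => (↑x⁻¹ : F →L[ℝ] F) (b i)) =
        (↑x⁻¹ : F →L[ℝ] F).toLinearMap '' Set.range (fun i => (b i : F)) := by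
      rw [← Set.range_comp]; rfl
    rw [h2, ← Submodule.map_span, hspan, ← hmap, ← Submodule.map_comp]
    have : (↑x⁻¹ : F →L[ℝ] F).toLinearMap ∘ₗ (T y).toLinearMap = LinearMap.id :=
      LinearMap.ext hl
    rw [this, Submodule.map_id]

end ConstantRank

/-! ### Contact components of a Lie bracket in coordinates. -/

section Bracket

open Filter Topology VectorField

variable {n m k : ℕ} {F : Type*} [NormedAddCommGroup F] [NormedSpace ℝ F]

/-- On sections of the induced Cartan distribution, the contact components of the Lie bracket are
given by the curvature. -/
theorem contactForm_fderiv_lieBracket {Φ : F → JetSpace n m k} {X Y : F → F} {y : F}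
    (hΦ : ContDiffAt ℝ 2 Φ y) (hX : DifferentiableAt ℝ X y) (hY : DifferentiableAt ℝ Y y)
    (hXc : ∀ᶠ z in 𝓝 y, fderiv ℝ Φ z (X z) ∈ cartan (Φ z))
    (hYc : ∀ᶠ z in 𝓝 y, fderiv ℝ Φ z (Y z) ∈ cartan (Φ z))
    (σ : Fin n → ℕ) (hσ : ∑ l, σ l < k) (j : Fin m) :
    contactForm (Φ y) σ hσ j (fderiv ℝ Φ y (lieBracket ℝ X Y y)) =
      curvature σ hσ j (fderiv ℝ Φ y (X y)) (fderiv ℝ Φ y (Y y)) := by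
  have hΦd : DifferentiableAt ℝ Φ y := hΦ.differentiableAt (by norm_num)
  have hΦ' : DifferentiableAt ℝ (fderiv ℝ Φ) y :=
    (hΦ.fderiv_right (m := 1) (by norm_num)).differentiableAt (by norm_num)
  have hsymm : IsSymmSndFDerivAt ℝ Φ y := hΦ.isSymmSndFDerivAt (by simp)
  -- Differentiate along `X` the identity saying that `dΦ(Y)` is annihilated by the contact form.
  -- The contact form of the derivative of `dΦ(Y)` is what remains after moving the derivative of
  -- the coefficients `u_{σ+1_i}` to the other side.
  have key : ∀ X Y : F → F, DifferentiableAt ℝ Y y →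
      (∀ᶠ z in 𝓝 y, fderiv ℝ Φ z (Y z) ∈ cartan (Φ z)) →
      contactForm (Φ y) σ hσ j (fderiv ℝ (fderiv ℝ Φ) y (X y) (Y y) +
        fderiv ℝ Φ y (fderiv ℝ Y y (X y))) =
      ∑ i, (fderiv ℝ Φ y (X y)).2 (raise σ hσ i) j * (fderiv ℝ Φ y (Y y)).1 i := by
    intro X Y hY hYc
    let Q : F → JetSpace n m k := fun z => fderiv ℝ Φ z (Y z)
    have hQ : HasFDerivAt Q ((fderiv ℝ Φ y).comp (fderiv ℝ Y y) +
        (fderiv ℝ (fderiv ℝ Φ) y).flip (Y y)) y := hΦ'.hasFDerivAt.clm_apply hY.hasFDerivAt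
    let c₂ (τ : MultiIndex n k) : JetSpace n m k →L[ℝ] ℝ :=
      (ContinuousLinearMap.proj (R := ℝ) (φ := fun _ : Fin m => ℝ) j).comp
        ((ContinuousLinearMap.proj (R := ℝ) (φ := fun _ : MultiIndex n k => Fin m → ℝ) τ).comp
          (ContinuousLinearMap.snd ℝ _ _))
    let c₁ (i : Fin n) : JetSpace n m k →L[ℝ] ℝ :=
      (ContinuousLinearMap.proj (R := ℝ) (φ := fun _ : Fin n => ℝ) i).comp
        (ContinuousLinearMap.fst ℝ _ _)
    have hQ₂ := (c₂ ⟨σ, hσ.le⟩).hasFDerivAt.comp y hQ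
    have hsum : HasFDerivAt (fun z => ∑ i, c₂ (raise σ hσ i) (Φ z) * c₁ i (Q z)) _ y :=
      HasFDerivAt.fun_sum fun i _ =>
        ((c₂ (raise σ hσ i)).hasFDerivAt.comp y hΦd.hasFDerivAt).mul
          ((c₁ i).hasFDerivAt.comp y hQ)
    have heq : (c₂ ⟨σ, hσ.le⟩ ∘ Q) =ᶠ[𝓝 y]
        fun z => ∑ i, c₂ (raise σ hσ i) (Φ z) * c₁ i (Q z) := by
      filter_upwards [hYc] with z hz
      have := mem_cartan.mp hz σ hσ j
      rw [contactForm_apply, sub_eq_zero] at this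
      exact this
    have := congrArg (fun L : F →L[ℝ] ℝ => L (X y)) (hQ₂.unique (hsum.congr_of_eventuallyEq heq))
    simp [c₁, c₂, Q] at this
    rw [contactForm_apply]
    simp only [Prod.fst_add, Prod.snd_add, Pi.add_apply]
    rw [sub_eq_iff_eq_add, ← Finset.sum_add_distrib, add_comm, this]
    exact Finset.sum_congr rfl fun i _ => by ring
  -- Antisymmetrizing in `X` and `Y` cancels the symmetric second derivative of `Φ`.
  have hbr : fderiv ℝ Φ y (lieBracket ℝ X Y y) =
      (fderiv ℝ (fderiv ℝ Φ) y (X y) (Y y) + fderiv ℝ Φ y (fderiv ℝ Y y (X y))) -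
      (fderiv ℝ (fderiv ℝ Φ) y (Y y) (X y) + fderiv ℝ Φ y (fderiv ℝ X y (Y y))) := by
    rw [hsymm.eq (X y) (Y y), lieBracket, map_sub]
    abel
  rw [hbr, map_sub, key X Y hY hYc, key Y X hX hXc, curvature_apply, Finset.sum_sub_distrib]

end Bracket

/-! ### Smooth distributions on a manifold and their description in charts. -/

section Distributions

open Filter Topology VectorField

variable {d : ℕ} {M : Type*} [TopologicalSpace M] [ChartedSpace (EuclideanSpace ℝ (Fin d)) M]

theorem IsSmoothDistribution.finrank_eq {r : ℕ}
    {D : (x : M) → Submodule ℝ (TangentSpace (𝓡 d) x)} [IsManifold (𝓡 d) ∞ M]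
    (hD : IsSmoothDistribution r D) (a : M) : Module.finrank ℝ (D a) = r := by
  obtain ⟨U, -, ha, X, -, hX⟩ := hD a
  rw [← (hX a ha).2, finrank_span_eq_card (hX a ha).1, Fintype.card_fin]

/-- Constant coefficients in a local frame extend a vector to a section; this turns statements about
sections into pointwise ones. -/
theorem IsSmoothDistribution.exists_section {r : ℕ} [IsManifold (𝓡 d) ∞ M]
    {D : (x : M) → Submodule ℝ (TangentSpace (𝓡 d) x)} (hD : IsSmoothDistribution r D) (a : M)
    {v : TangentSpace (𝓡 d) a} (hv : v ∈ D a) :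
    ∃ U : Set M, IsOpen U ∧ a ∈ U ∧ ∃ X : (x : M) → TangentSpace (𝓡 d) x,
      IsSectionOn D U X ∧ X a = v := by
  obtain ⟨U, hU, ha, X, hXs, hX⟩ := hD a
  rw [← (hX a ha).2, Submodule.mem_span_range_iff_exists_fun] at hv
  obtain ⟨c, hc⟩ := hv
  refine ⟨U, hU, ha, fun x => ∑ i, c i • X i x, ⟨?_, fun x hx => ?_⟩, hc⟩
  · exact ContMDiffOn.sum_section (t := fun i x => c i • X i x)
      fun i _ => ContMDiffOn.const_smul_section (hXs i)
  · rw [← (hX x hx).2]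
    exact Submodule.sum_mem _ fun i _ =>
      Submodule.smul_mem _ _ (Submodule.subset_span (Set.mem_range_self i))

/-- The differential at `x` of the chart centred at `a`. -/
def chartDeriv (a x : M) : TangentSpace (𝓡 d) x →L[ℝ] EuclideanSpace ℝ (Fin d) :=
  mfderiv (𝓡 d) 𝓘(ℝ, EuclideanSpace ℝ (Fin d)) (extChartAt (𝓡 d) a) x

variable [IsManifold (𝓡 d) ∞ M]

theorem exists_chartDeriv_eq {a x : M} (hx : x ∈ (extChartAt (𝓡 d) a).source) :
    ∃ e : TangentSpace (𝓡 d) x ≃L[ℝ] EuclideanSpace ℝ (Fin d),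
      (e : TangentSpace (𝓡 d) x →L[ℝ] EuclideanSpace ℝ (Fin d)) = chartDeriv (d := d) a x := by
  have : IsManifold (𝓡 d) 1 M := IsManifold.of_le (n := ∞) (by simp)
  exact isInvertible_mfderiv_extChartAt (I := 𝓡 d) hx

/-- Near `a`, the distribution `D` is spanned in the chart centred at `a` by smooth fields. -/
def HasCoordinateFrameAt (r : ℕ) (D : (x : M) → Submodule ℝ (TangentSpace (𝓡 d) x)) (a : M) :
    Prop :=
  ∃ V ⊆ (extChartAt (𝓡 d) a).target, IsOpen V ∧ extChartAt (𝓡 d) a a ∈ V ∧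
    ∃ Z : Fin r → EuclideanSpace ℝ (Fin d) → EuclideanSpace ℝ (Fin d),
      (∀ i, ContDiffOn ℝ ∞ (Z i) V) ∧
      ∀ x ∈ (extChartAt (𝓡 d) a).source, extChartAt (𝓡 d) a x ∈ V →
        LinearIndependent ℝ (fun i => Z i (extChartAt (𝓡 d) a x)) ∧
        Submodule.span ℝ (Set.range fun i => Z i (extChartAt (𝓡 d) a x)) =
          (D x).map (chartDeriv a x).toLinearMap

theorem isSmoothDistribution_of_hasCoordinateFrameAt {r : ℕ}
    {D : (x : M) → Submodule ℝ (TangentSpace (𝓡 d) x)}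
    (h : ∀ a, HasCoordinateFrameAt r D a) : IsSmoothDistribution r D := by
  intro a
  obtain ⟨V, hVt, hV, haV, Z, hZ, hspan⟩ := h a
  let φ := extChartAt (𝓡 d) a
  refine ⟨φ.source ∩ φ ⁻¹' V, (continuousOn_extChartAt a).isOpen_inter_preimage
    (isOpen_extChartAt_source a) hV, ⟨mem_extChartAt_source a, haV⟩,
    fun i => mpullback (𝓡 d) 𝓘(ℝ, EuclideanSpace ℝ (Fin d)) φ (Z i), fun i x hx => ?_,
    fun x hx => ?_⟩
  · have : IsManifold (𝓡 d) 1 M := IsManifold.of_le (n := ∞) (by simp)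
    refine ContMDiffAt.contMDiffWithinAt ?_
    refine ContMDiffAt.mpullback_vectorField_preimage (n := ∞) ?_ ?_
      (isInvertible_mfderiv_extChartAt (I := 𝓡 d) hx.1) (by simp)
    · refine contMDiffAt_vectorSpace_iff_contDiffAt.mpr ?_
      exact (hZ i).contDiffAt (hV.mem_nhds hx.2)
    · exact contMDiffAt_extChartAt' (by simpa [φ] using hx.1)
  · obtain ⟨e, he⟩ := exists_chartDeriv_eq hx.1
    obtain ⟨hli, hsp⟩ := hspan x hx.1 hx.2
    have hX : ∀ i, mpullback (𝓡 d) 𝓘(ℝ, EuclideanSpace ℝ (Fin d)) φ (Z i) x =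
        e.symm (Z i (φ x)) := by
      intro i
      change (chartDeriv a x).inverse _ = _
      rw [← he, ContinuousLinearMap.inverse_equiv]
      rfl
    simp only [hX]
    refine ⟨hli.map' e.symm.toLinearEquiv.toLinearMap e.symm.toLinearEquiv.ker, ?_⟩
    have h2 : Set.range (fun i => e.symm (Z i (φ x))) =
        e.symm.toLinearEquiv.toLinearMap '' Set.range (fun i => Z i (φ x)) := by
      rw [← Set.range_comp]; rfl
    rw [h2, ← Submodule.map_span, hsp, ← he, ← Submodule.map_comp]
    have : e.symm.toLinearEquiv.toLinearMap ∘ₗ (e : TangentSpace (𝓡 d) x →L[ℝ] _).toLinearMap =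
        LinearMap.id := LinearMap.ext e.symm_apply_apply
    rw [this, Submodule.map_id]

/-- A distribution of constant rank which in a chart is the kernel of a smooth family of linear
maps has a smooth coordinate frame. -/
theorem hasCoordinateFrameAt_of_kernel {G : Type*} [NormedAddCommGroup G] [NormedSpace ℝ G]
    [FiniteDimensional ℝ G] {r : ℕ} {D : (x : M) → Submodule ℝ (TangentSpace (𝓡 d) x)}
    (hr : ∀ x, Module.finrank ℝ (D x) = r) {a : M} {V : Set (EuclideanSpace ℝ (Fin d))}
    (hVt : V ⊆ (extChartAt (𝓡 d) a).target) (hV : IsOpen V) (haV : extChartAt (𝓡 d) a a ∈ V)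
    {A : EuclideanSpace ℝ (Fin d) → EuclideanSpace ℝ (Fin d) →L[ℝ] G} (hA : ContDiffOn ℝ ∞ A V)
    (hD : ∀ x ∈ (extChartAt (𝓡 d) a).source, extChartAt (𝓡 d) a x ∈ V →
      ∀ v, v ∈ D x ↔ A (extChartAt (𝓡 d) a x) (chartDeriv a x v) = 0) :
    HasCoordinateFrameAt r D a := by
  have hker : ∀ x ∈ (extChartAt (𝓡 d) a).source, extChartAt (𝓡 d) a x ∈ V →
      LinearMap.ker (A (extChartAt (𝓡 d) a x)).toLinearMap =
        (D x).map (chartDeriv a x).toLinearMap := by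
    intro x hx hxV
    obtain ⟨e, he⟩ := exists_chartDeriv_eq hx
    ext u
    constructor
    · intro hu
      refine ⟨e.symm u, ?_, ?_⟩
      · rw [SetLike.mem_coe, hD x hx hxV, ← he]
        simpa using hu
      · rw [← he]
        simp
    · rintro ⟨v, hv, rfl⟩
      exact (hD x hx hxV v).mp hv
  have hrank : ∀ y ∈ V, Module.finrank ℝ (LinearMap.ker (A y).toLinearMap) = r := by
    intro y hy
    have hys := (extChartAt (𝓡 d) a).map_target (hVt hy)
    have hyx := (extChartAt (𝓡 d) a).right_inv (hVt hy)
    have := hker _ hys (by rwa [hyx])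
    rw [hyx] at this
    obtain ⟨e, he⟩ := exists_chartDeriv_eq hys
    rw [this, ← he, ← hr ((extChartAt (𝓡 d) a).symm y)]
    exact (Submodule.equivMapOfInjective _ e.injective _).symm.finrank_eq
  obtain ⟨U, hUV, hU, haU, Z, hZ, hspan⟩ := exists_smooth_kernel_frame hV hA hrank haV
  refine ⟨U, hUV.trans hVt, hU, haU, Z, hZ, fun x hx hxU => ?_⟩
  rw [← hker x hx (hUV hxU)]
  exact hspan _ hxU

end Distributions

/-! ### The inclusion of the equation in charts, and brackets on the equation. -/

section Systems

open Filter Topology VectorField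

variable {n m k d : ℕ} {E : Type*} [TopologicalSpace E]
  [ChartedSpace (EuclideanSpace ℝ (Fin d)) E]

theorem injective_dInclusion {ι : E → JetSpace n m k}
    (hι : Manifold.IsSmoothEmbedding (𝓡 d) 𝓘(ℝ, JetSpace n m k) ∞ ι) (a : E) :
    Function.Injective (dInclusion (d := d) ι a) := by
  have h := hι.isImmersion.isImmersionAt a
  let ψ := h.domChart.extend (𝓡 d)
  let χ := h.codChart.extend 𝓘(ℝ, JetSpace n m k)
  let L : JetSpace n m k →L[ℝ] EuclideanSpace ℝ (Fin d) :=
    (ContinuousLinearMap.fst ℝ _ _).comp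
      (h.equiv.symm : JetSpace n m k →L[ℝ] EuclideanSpace ℝ (Fin d) × h.complement)
  have hL : ∀ x ∈ h.domChart.source, L (χ (ι x)) = ψ x := by
    intro x hx
    have hx' : x ∈ ψ.source := by simpa [ψ] using hx
    have := h.writtenInCharts (ψ.map_source hx')
    simp only [Function.comp_apply] at this
    rw [ψ.left_inv hx'] at this
    change L (χ (ι x)) = ψ x
    simp only [χ, this, L]
    simp
  -- In the immersion charts `ι` is a slice inclusion, so projecting to the slice gives a local left
  -- inverse, differentiable at `ι a`; hence the differential of `ι` has a left inverse.
  let ρ : JetSpace n m k → E := fun y => ψ.symm (L (χ y))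
  have hρ : ρ ∘ ι =ᶠ[𝓝 a] id := by
    filter_upwards [h.domChart.open_source.mem_nhds h.mem_domChart_source] with x hx
    have hx' : x ∈ ψ.source := by simpa [ψ] using hx
    change ψ.symm (L (χ (ι x))) = x
    rw [hL x hx, ψ.left_inv hx']
  have hρd : MDifferentiableAt 𝓘(ℝ, JetSpace n m k) (𝓡 d) ρ (ι a) := by
    have h1 : ContMDiffAt 𝓘(ℝ, JetSpace n m k) 𝓘(ℝ, JetSpace n m k) ∞ χ (ι a) :=
      OpenPartialHomeomorph.contMDiffAt_extend h.codChart_mem_maximalAtlas h.mem_codChart_source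
    have h2 : ContMDiffAt 𝓘(ℝ, JetSpace n m k) 𝓘(ℝ, EuclideanSpace ℝ (Fin d)) ∞
        (fun y => L (χ y)) (ι a) := L.contMDiff.contMDiffAt.comp (ι a) h1
    have h3 : ContMDiffAt 𝓘(ℝ, EuclideanSpace ℝ (Fin d)) (𝓡 d) ∞ ψ.symm (L (χ (ι a))) := by
      rw [hL a h.mem_domChart_source]
      have := contMDiffOn_extend_symm (I := 𝓡 d) h.domChart_mem_maximalAtlas
      have hz : ψ a ∈ ψ.target := ψ.map_source (by simpa [ψ] using h.mem_domChart_source)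
      refine this.contMDiffAt (IsOpen.mem_nhds ?_ ?_)
      · simpa using h.domChart.open_target
      · simpa [ψ] using hz
    exact (h3.comp (ι a) h2).mdifferentiableAt (by simp)
  have hιd : MDifferentiableAt (𝓡 d) 𝓘(ℝ, JetSpace n m k) ι a :=
    hι.contMDiff.contMDiffAt.mdifferentiableAt (by simp)
  have hcomp := mfderiv_comp a hρd hιd
  rw [hρ.mfderiv_eq, mfderiv_id] at hcomp
  exact Function.LeftInverse.injective
    (g := mfderiv 𝓘(ℝ, JetSpace n m k) (𝓡 d) ρ (ι a))
    fun v => (congrArg (fun T : TangentSpace (𝓡 d) a →L[ℝ] TangentSpace (𝓡 d) a => T v) hcomp).symm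

theorem dBase_apply {ι : E → JetSpace n m k}
    (hι : ContMDiff (𝓡 d) 𝓘(ℝ, JetSpace n m k) ∞ ι) (a : E) (v : TangentSpace (𝓡 d) a) :
    dBase ι a v = (dInclusion ι a v).1 := by
  have hιd : MDifferentiableAt (𝓡 d) 𝓘(ℝ, JetSpace n m k) ι a :=
    hι.contMDiffAt.mdifferentiableAt (by simp)
  let P : JetSpace n m k →L[ℝ] (Fin n → ℝ) := ContinuousLinearMap.fst ℝ _ _
  have := (P.hasMFDerivAt (x := ι a)).comp a hιd.hasMFDerivAt
  exact congrArg (fun T : TangentSpace (𝓡 d) a →L[ℝ] (Fin n → ℝ) => T v) this.mfderiv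

variable [IsManifold (𝓡 d) ∞ E]

theorem contDiffOn_comp_extChartAt_symm {ι : E → JetSpace n m k}
    (hι : ContMDiff (𝓡 d) 𝓘(ℝ, JetSpace n m k) ∞ ι) (a : E) :
    ContDiffOn ℝ ∞ (ι ∘ (extChartAt (𝓡 d) a).symm) (extChartAt (𝓡 d) a).target :=
  contMDiffOn_iff_contDiffOn.mp (hι.comp_contMDiffOn (contMDiffOn_extChartAt_symm a))

theorem fderiv_chartDeriv {ι : E → JetSpace n m k}
    (hι : ContMDiff (𝓡 d) 𝓘(ℝ, JetSpace n m k) ∞ ι) {a x : E}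
    (hx : x ∈ (extChartAt (𝓡 d) a).source) (v : TangentSpace (𝓡 d) x) :
    fderiv ℝ (ι ∘ (extChartAt (𝓡 d) a).symm) (extChartAt (𝓡 d) a x) (chartDeriv a x v) =
      dInclusion ι x v := by
  have hΦ : DifferentiableAt ℝ (ι ∘ (extChartAt (𝓡 d) a).symm) (extChartAt (𝓡 d) a x) :=
    ((contDiffOn_comp_extChartAt_symm hι a).contDiffAt ((isOpen_extChartAt_target a).mem_nhds
      ((extChartAt (𝓡 d) a).map_source hx))).differentiableAt (by simp)
  have hφ : MDifferentiableAt (𝓡 d) 𝓘(ℝ, EuclideanSpace ℝ (Fin d)) (extChartAt (𝓡 d) a) x :=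
    (contMDiffAt_extChartAt' (n := ∞) (by simpa using hx)).mdifferentiableAt (by simp)
  have hcomp := hΦ.hasFDerivAt.hasMFDerivAt.comp x hφ.hasMFDerivAt
  have heq : (ι ∘ (extChartAt (𝓡 d) a).symm) ∘ extChartAt (𝓡 d) a =ᶠ[𝓝 x] ι := by
    filter_upwards [(isOpen_extChartAt_source a).mem_nhds hx] with y hy
    simp only [Function.comp_apply, (extChartAt (𝓡 d) a).left_inv hy]
  have := (hcomp.congr_of_eventuallyEq heq.symm).mfderiv
  exact (congrArg (fun T : TangentSpace (𝓡 d) x →L[ℝ] JetSpace n m k => T v) this).symm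

/-- The contact components of the bracket of two sections of the induced Cartan distribution. -/
theorem contactForm_mlieBracket {ι : E → JetSpace n m k}
    (hι : ContMDiff (𝓡 d) 𝓘(ℝ, JetSpace n m k) ∞ ι) {U : Set E} (hU : IsOpen U)
    {X Y : (x : E) → TangentSpace (𝓡 d) x} (hX : IsSectionOn (inducedCartan ι) U X)
    (hY : IsSectionOn (inducedCartan ι) U Y) {x : E} (hx : x ∈ U)
    (σ : Fin n → ℕ) (hσ : ∑ l, σ l < k) (j : Fin m) :
    contactForm (ι x) σ hσ j (dInclusion ι x (mlieBracket (𝓡 d) X Y x)) =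
      curvature σ hσ j (dInclusion ι x (X x)) (dInclusion ι x (Y x)) := by
  let φ := extChartAt (𝓡 d) x
  let Φ := ι ∘ φ.symm
  have hxs : x ∈ φ.source := mem_extChartAt_source x
  -- `pull X` is the coordinate expression of `X` in the chart at `x`; `dΦ` applied to it is `dι`
  -- applied to `X` near `x`.
  let pull : ((x : E) → TangentSpace (𝓡 d) x) → EuclideanSpace ℝ (Fin d) →
      EuclideanSpace ℝ (Fin d) := fun X =>
    mpullbackWithin 𝓘(ℝ, EuclideanSpace ℝ (Fin d)) (𝓡 d) φ.symm X (Set.range (𝓡 d))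
  have hdiff : ∀ X, IsSectionOn (inducedCartan ι) U X → DifferentiableAt ℝ (pull X) (φ x) := by
    intro X hX
    have h1 := (hX.1.contMDiffAt (hU.mem_nhds hx)).contMDiffWithinAt (s := Set.univ)
    have h2 := contMDiffWithinAt_mpullbackWithin_extChartAt_symm (n := ∞) h1
      uniqueMDiffOn_univ (Set.mem_univ x) (by simp)
    rw [contMDiffWithinAt_vectorSpace_iff_contDiffWithinAt] at h2
    exact (h2.contDiffAt
      (by simpa using extChartAt_target_mem_nhds (I := 𝓡 d) x)).differentiableAt (by simp)
  have hpush : ∀ X, ∀ᶠ y in 𝓝 x, fderiv ℝ Φ (φ y) (pull X (φ y)) = dInclusion ι y (X y) := by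
    intro X
    have h1 := eventuallyEq_mpullback_mpullbackWithin_extChartAt (I := 𝓡 d) (x := x)
      (s := Set.univ) X
    rw [nhdsWithin_univ] at h1
    filter_upwards [h1, extChartAt_source_mem_nhds (I := 𝓡 d) x] with y hy hys
    obtain ⟨e, he⟩ := exists_chartDeriv_eq hys
    have h2 : X y = e.symm (pull X (φ y)) := by
      rw [hy]
      change (chartDeriv x y).inverse _ = _
      rw [← he, ContinuousLinearMap.inverse_equiv]
      rfl
    rw [← fderiv_chartDeriv hι hys, h2, ← he]
    simp [Φ, φ]
  have hcart : ∀ X, IsSectionOn (inducedCartan ι) U X →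
      ∀ᶠ z in 𝓝 (φ x), fderiv ℝ Φ z (pull X z) ∈ cartan (Φ z) := by
    intro X hX
    have h1 : ∀ᶠ y in 𝓝 x, fderiv ℝ Φ (φ y) (pull X (φ y)) ∈ cartan (Φ (φ y)) := by
      filter_upwards [hpush X, hU.mem_nhds hx, extChartAt_source_mem_nhds (I := 𝓡 d) x]
        with y hy hyU hys
      rw [hy]
      simp only [Φ, Function.comp_apply]
      rw [φ.left_inv hys]
      exact hX.2 y hyU
    have h2 : Tendsto φ.symm (𝓝 (φ x)) (𝓝 x) := by
      have := continuousAt_extChartAt_symm (I := 𝓡 d) x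
      rwa [ContinuousAt, extChartAt_to_inv] at this
    filter_upwards [h2.eventually h1, extChartAt_target_mem_nhds (I := 𝓡 d) x] with z hz hzt
    rwa [φ.right_inv hzt] at hz
  have hΦ : ContDiffAt ℝ 2 Φ (φ x) :=
    ((contDiffOn_comp_extChartAt_symm hι x).contDiffAt
      (extChartAt_target_mem_nhds x)).of_le (by norm_cast)
  have key := contactForm_fderiv_lieBracket hΦ (hdiff X hX) (hdiff Y hY) (hcart X hX)
    (hcart Y hY) σ hσ j
  rw [(hpush X).self_of_nhds, (hpush Y).self_of_nhds] at key
  have hΦx : Φ (φ x) = ι x := by simp [Φ, φ]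
  rw [← key, hΦx]
  congr 1
  obtain ⟨e, he⟩ := exists_chartDeriv_eq hxs
  have hbr : mlieBracket (𝓡 d) X Y x = e.symm (lieBracket ℝ (pull X) (pull Y) (φ x)) := by
    rw [← mlieBracketWithin_univ, mlieBracketWithin_apply]
    change (chartDeriv x x).inverse _ = _
    rw [← he, ContinuousLinearMap.inverse_equiv]
    have hset : φ.symm ⁻¹' Set.univ ∩ Set.range (𝓡 d) = Set.univ := by simp
    change e.symm (lieBracketWithin ℝ (pull X) (pull Y)
      (φ.symm ⁻¹' Set.univ ∩ Set.range (𝓡 d)) (φ x)) = _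
    rw [hset, lieBracketWithin_univ]
  rw [hbr, ← fderiv_chartDeriv hι hxs, ← he]
  simp [Φ, φ]

end Systems

/-! ### Smooth families of linear equations cutting out the two distributions. -/

section SmoothFamilies

variable {n m k : ℕ} {F : Type*} [NormedAddCommGroup F] [NormedSpace ℝ F]

instance instFiniteLowMultiIndex (n k : ℕ) : Finite {σ : Fin n → ℕ // ∑ i, σ i < k} :=
  Finite.of_injective (fun σ => (⟨σ.1, σ.2.le⟩ : MultiIndex n k))
    fun _ _ h => Subtype.ext (by simpa using h)

instance instFintypeLowMultiIndex (n k : ℕ) : Fintype {σ : Fin n → ℕ // ∑ i, σ i < k} :=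
  Fintype.ofFinite _

theorem contDiffOn_contactForm {U : Set F} {Φ P : F → JetSpace n m k}
    (hΦ : ContDiffOn ℝ ∞ Φ U) (hP : ContDiffOn ℝ ∞ P U) (σ : Fin n → ℕ)
    (hσ : ∑ l, σ l < k) (j : Fin m) :
    ContDiffOn ℝ ∞ (fun y => contactForm (Φ y) σ hσ j (P y)) U := by
  have h2 : ∀ {P : F → JetSpace n m k}, ContDiffOn ℝ ∞ P U → ∀ τ,
      ContDiffOn ℝ ∞ (fun y => (P y).2 τ j) U := fun h τ =>
    contDiffOn_pi.mp (contDiffOn_pi.mp h.snd τ) j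
  exact (h2 hP _).sub (ContDiffOn.sum fun i _ => (h2 hΦ _).mul (contDiffOn_pi.mp hP.fst i))

theorem contDiffOn_curvature {U : Set F} {P Q : F → JetSpace n m k}
    (hP : ContDiffOn ℝ ∞ P U) (hQ : ContDiffOn ℝ ∞ Q U) (σ : Fin n → ℕ)
    (hσ : ∑ l, σ l < k) (j : Fin m) :
    ContDiffOn ℝ ∞ (fun y => curvature σ hσ j (P y) (Q y)) U := by
  have h2 : ∀ {P : F → JetSpace n m k}, ContDiffOn ℝ ∞ P U → ∀ τ,
      ContDiffOn ℝ ∞ (fun y => (P y).2 τ j) U := fun h τ =>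
    contDiffOn_pi.mp (contDiffOn_pi.mp h.snd τ) j
  simp only [curvature_apply]
  exact ContDiffOn.sum fun i _ => ((h2 hP _).mul (contDiffOn_pi.mp hQ.fst i)).sub
    ((h2 hQ _).mul (contDiffOn_pi.mp hP.fst i))

variable [FiniteDimensional ℝ F]

/-- The contact forms pulled back by `Φ`. -/
def pulledContact (Φ : F → JetSpace n m k) (y : F) :
    F →L[ℝ] ({σ : Fin n → ℕ // ∑ i, σ i < k} × Fin m → ℝ) :=
  LinearMap.toContinuousLinearMap (LinearMap.pi fun s =>
    contactForm (Φ y) s.1.1 s.1.2 s.2 ∘ₗ (fderiv ℝ Φ y).toLinearMap)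

theorem pulledContact_eq_zero_iff {Φ : F → JetSpace n m k} {y u : F} :
    pulledContact Φ y u = 0 ↔ fderiv ℝ Φ y u ∈ cartan (Φ y) := by
  rw [mem_cartan, funext_iff]
  exact ⟨fun h σ hσ j => h (⟨σ, hσ⟩, j), fun h s => h _ s.1.2 _⟩

theorem contDiffOn_pulledContact {U : Set F} (hU : IsOpen U) {Φ : F → JetSpace n m k}
    (hΦ : ContDiffOn ℝ ∞ Φ U) : ContDiffOn ℝ ∞ (pulledContact Φ) U := by
  rw [contDiffOn_clm_apply]
  intro u
  rw [contDiffOn_pi]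
  exact fun s => contDiffOn_contactForm hΦ
    ((hΦ.fderiv_of_isOpen hU (by simp)).clm_apply contDiffOn_const) _ _ _

/-- The curvature pulled back by `Φ`, contracted with the fields `Z`. -/
def pulledCurvature {ρ : Type*} [Fintype ρ] (Φ : F → JetSpace n m k) (Z : ρ → F → F) (y : F) :
    F →L[ℝ] ({σ : Fin n → ℕ // ∑ i, σ i < k} × Fin m × ρ → ℝ) :=
  LinearMap.toContinuousLinearMap (LinearMap.pi fun s =>
    (curvature s.1.1 s.1.2 s.2.1).flip (fderiv ℝ Φ y (Z s.2.2 y)) ∘ₗ (fderiv ℝ Φ y).toLinearMap)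

theorem pulledCurvature_eq_zero_iff {ρ : Type*} [Fintype ρ] {Φ : F → JetSpace n m k}
    {Z : ρ → F → F} {y u : F} : pulledCurvature Φ Z y u = 0 ↔
      ∀ i σ (hσ : ∑ l, σ l < k) j,
        curvature σ hσ j (fderiv ℝ Φ y u) (fderiv ℝ Φ y (Z i y)) = 0 := by
  rw [funext_iff]
  exact ⟨fun h i σ hσ j => h (⟨σ, hσ⟩, j, i), fun h s => h _ _ s.1.2 _⟩

theorem contDiffOn_pulledCurvature {ρ : Type*} [Fintype ρ] {U : Set F} (hU : IsOpen U)
    {Φ : F → JetSpace n m k} (hΦ : ContDiffOn ℝ ∞ Φ U) {Z : ρ → F → F}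
    (hZ : ∀ i, ContDiffOn ℝ ∞ (Z i) U) : ContDiffOn ℝ ∞ (pulledCurvature Φ Z) U := by
  rw [contDiffOn_clm_apply]
  intro u
  rw [contDiffOn_pi]
  have h := hΦ.fderiv_of_isOpen (m := ∞) hU (by simp)
  exact fun s => contDiffOn_curvature (h.clm_apply contDiffOn_const) (h.clm_apply (hZ _)) _ _ _

end SmoothFamilies

/-! ### The radical distribution: smoothness, Cauchy property and maximality. -/

section Systems

open Filter Topology VectorField

variable {n m k d : ℕ} {E : Type*} [TopologicalSpace E]
  [ChartedSpace (EuclideanSpace ℝ (Fin d)) E] {ι : E → JetSpace n m k}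

theorem exists_symbol_eq_span (hinv : IsInvolutiveSystem d ι) (hclass : IsOfClass d 1 ι) (a : E) :
    ∃ (p : Module.Dual ℝ (Fin n → ℝ)) (v : Fin m → ℝ), p ≠ 0 ∧ v ≠ 0 ∧
      symbol (d := d) ι a = ℝ ∙ powTensor p k v :=
  exists_eq_span_powTensor inf_le_left (hinv.1 a) (hclass a)

/-- Injectivity of `ι` ensures that the tangent space containing the horizontal plane is the one at
`a` itself. -/
theorem exists_prolongation_over (hinj : Function.Injective ι)
    (hinv : IsInvolutiveSystem d ι) (a : E) :
    ∃ θ : JetSpace n m (k + 1), truncate θ = ι a ∧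
      ∀ i, totalDerivative θ i ∈ LinearMap.range (dInclusion (d := d) ι a) := by
  obtain ⟨θ, ⟨b, hb, hθ⟩, hθa⟩ := hinv.2 ⟨a, rfl⟩
  obtain rfl : b = a := hinj (hb.symm.trans hθa)
  exact ⟨θ, hb, hθ⟩

/-- The radical of the curvature of the induced Cartan distribution. -/
def cauchyDistribution (ι : E → JetSpace n m k) (a : E) :
    Submodule ℝ (TangentSpace (𝓡 d) a) :=
  curvatureRadical (dInclusion ι a) (inducedCartan ι a)

variable [IsManifold (𝓡 d) ∞ E]

theorem hasCoordinateFrameAt_inducedCartan (hι : ContMDiff (𝓡 d) 𝓘(ℝ, JetSpace n m k) ∞ ι) {r : ℕ}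
    (hr : ∀ x, Module.finrank ℝ (inducedCartan (d := d) ι x) = r) (a : E) :
    HasCoordinateFrameAt r (inducedCartan (d := d) ι) a := by
  refine hasCoordinateFrameAt_of_kernel hr subset_rfl (isOpen_extChartAt_target a)
    (mem_extChartAt_target a) (contDiffOn_pulledContact (isOpen_extChartAt_target a)
      (contDiffOn_comp_extChartAt_symm hι a)) fun x hx _ v => ?_
  rw [pulledContact_eq_zero_iff, fderiv_chartDeriv hι hx, Function.comp_apply,
    (extChartAt (𝓡 d) a).left_inv hx]
  rfl

/-- By linearity the radical condition need only be tested on a local frame of the Cartan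
distribution, which leaves finitely many smooth linear equations. The frame `Z` of that distribution
is therefore needed beforehand. -/
theorem hasCoordinateFrameAt_cauchyDistribution
    (hι : ContMDiff (𝓡 d) 𝓘(ℝ, JetSpace n m k) ∞ ι) {r s : ℕ}
    (hr : ∀ x, Module.finrank ℝ (inducedCartan (d := d) ι x) = r)
    (hs : ∀ x, Module.finrank ℝ (cauchyDistribution (d := d) ι x) = s) (a : E) :
    HasCoordinateFrameAt s (cauchyDistribution (d := d) ι) a := by
  obtain ⟨V, hVt, hV, haV, Z, hZ, hspan⟩ := hasCoordinateFrameAt_inducedCartan hι hr a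
  have hΦ := (contDiffOn_comp_extChartAt_symm hι a).mono hVt
  refine hasCoordinateFrameAt_of_kernel hs hVt hV haV
    (A := fun y => (pulledContact (ι ∘ (extChartAt (𝓡 d) a).symm) y).prod
      (pulledCurvature (ι ∘ (extChartAt (𝓡 d) a).symm) Z y)) ?_ fun x hx hxV v => ?_
  · rw [contDiffOn_clm_apply]
    exact fun u => ((contDiffOn_pulledContact hV hΦ).clm_apply contDiffOn_const).prodMk
      ((contDiffOn_pulledCurvature hV hΦ hZ).clm_apply contDiffOn_const)
  · rw [ContinuousLinearMap.prod_apply, Prod.mk_eq_zero, pulledContact_eq_zero_iff,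
      pulledCurvature_eq_zero_iff, fderiv_chartDeriv hι hx, Function.comp_apply,
      (extChartAt (𝓡 d) a).left_inv hx]
    refine and_congr Iff.rfl ?_
    have hsp := (hspan x hx hxV).2
    constructor
    · intro h i σ hσ j
      have : Z i (extChartAt (𝓡 d) a x) ∈ (inducedCartan ι x).map (chartDeriv a x).toLinearMap :=
        hsp ▸ Submodule.subset_span (Set.mem_range_self i)
      obtain ⟨y, hy, hyZ⟩ := this
      have hyZ' : chartDeriv a x y = Z i (extChartAt (𝓡 d) a x) := hyZ
      rw [← hyZ', fderiv_chartDeriv hι hx]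
      exact h y hy σ hσ j
    · intro h y hy σ hσ j
      have hmem : chartDeriv a x y ∈
          Submodule.span ℝ (Set.range fun i => Z i (extChartAt (𝓡 d) a x)) :=
        hsp ▸ Submodule.mem_map_of_mem hy
      rw [← fderiv_chartDeriv hι hx y]
      obtain ⟨c, hc⟩ := Submodule.mem_span_range_iff_exists_fun ℝ |>.mp hmem
      rw [← hc, map_sum, map_sum]
      refine Finset.sum_eq_zero fun i _ => ?_
      rw [map_smul, map_smul, h, smul_zero]

/-- Sections of the radical of the curvature are Cauchy characteristics. -/
theorem consistsOfCauchyCharacteristics_cauchyDistribution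
    (hι : ContMDiff (𝓡 d) 𝓘(ℝ, JetSpace n m k) ∞ ι) :
    ConsistsOfCauchyCharacteristics (cauchyDistribution (d := d) ι) (inducedCartan ι) := by
  intro U _ X hX
  have hXC : IsSectionOn (inducedCartan ι) U X := ⟨hX.1, fun x hx => (hX.2 x hx).1⟩
  refine ⟨hXC, fun V hV hVU Y hY x hx => ?_⟩
  change dInclusion ι x (mlieBracket (𝓡 d) X Y x) ∈ cartan (ι x)
  rw [mem_cartan]
  intro σ hσ j
  rw [contactForm_mlieBracket hι hV ⟨hXC.1.mono hVU, fun y hy => hXC.2 y (hVU hy)⟩ hY hx]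
  exact (hX.2 x (hVU hx)).2 _ (hY.2 x hx) σ hσ j

/-- A smooth distribution of Cauchy characteristics lies in the radical of the curvature. -/
theorem le_cauchyDistribution (hι : ContMDiff (𝓡 d) 𝓘(ℝ, JetSpace n m k) ∞ ι) {r s : ℕ}
    (hC : IsSmoothDistribution r (inducedCartan (d := d) ι))
    {Q : (a : E) → Submodule ℝ (TangentSpace (𝓡 d) a)} (hQ : IsSmoothDistribution s Q)
    (hcauchy : ConsistsOfCauchyCharacteristics Q (inducedCartan ι)) (a : E) :
    Q a ≤ cauchyDistribution ι a := by
  intro v hv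
  obtain ⟨U, hU, haU, X, hX, rfl⟩ := hQ.exists_section a hv
  obtain ⟨hXC, hbr⟩ := hcauchy U hU X hX
  refine ⟨hXC.2 a haU, fun y hy σ hσ j => ?_⟩
  -- Once both vectors are extended to sections, the bracket lies in the Cartan distribution, and
  -- its vanishing contact components are the curvature of the two vectors.
  obtain ⟨V, hV, haV, Y, hY, rfl⟩ := hC.exists_section a hy
  have hYUV : IsSectionOn (inducedCartan ι) (U ∩ V) Y :=
    ⟨hY.1.mono Set.inter_subset_right, fun x hx => hY.2 x hx.2⟩
  have hXUV : IsSectionOn (inducedCartan ι) (U ∩ V) X :=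
    ⟨hXC.1.mono Set.inter_subset_left, fun x hx => hXC.2 x hx.1⟩
  have h := hbr (U ∩ V) (hU.inter hV) Set.inter_subset_left Y hYUV a ⟨haU, haV⟩
  rw [← contactForm_mlieBracket hι (hU.inter hV) hXUV hYUV ⟨haU, haV⟩]
  exact mem_cartan.mp h σ hσ j

end Systems

end JetPDE

end

/-! ### Assembly of the main theorem. -/

theorem mainTheorem5 {n m k d : ℕ} (hk : 1 ≤ k)
    {E : Type*} [TopologicalSpace E] [ChartedSpace (EuclideanSpace ℝ (Fin d)) E]
    [IsManifold (𝓡 d) ∞ E]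
    (ι : E → JetPDE.JetSpace n m k)
    (hι : Manifold.IsSmoothEmbedding (𝓡 d) 𝓘(ℝ, JetPDE.JetSpace n m k) ∞ ι)
    (hinv : JetPDE.IsInvolutiveSystem d ι)
    (hclass : JetPDE.IsOfClass d 1 ι) :
    JetPDE.IsSmoothDistribution (n + 1) (JetPDE.inducedCartan (d := d) ι) ∧
    (∀ a, ∃ P, JetPDE.characteristicVariety d ι a = {P}) ∧
    ∀ p : E → Projectivization ℝ (Module.Dual ℝ (Fin n → ℝ)),
      (∀ a, p a ∈ JetPDE.characteristicVariety d ι a) →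
      ∃! Q : (a : E) → Submodule ℝ (TangentSpace (𝓡 d) a),
        JetPDE.IsSmoothDistribution (n - 1) Q ∧
        (∀ a, Q a ≤ JetPDE.inducedCartan ι a) ∧
        (∀ a, (Q a).map (JetPDE.dBase ι a) = LinearMap.ker (p a).rep) ∧
        JetPDE.ConsistsOfCauchyCharacteristics Q (JetPDE.inducedCartan ι) := by
  have hsm := hι.contMDiff
  have hθ := JetPDE.exists_prolongation_over hι.isEmbedding.injective hinv
  have hrank : ∀ a, Module.finrank ℝ (JetPDE.inducedCartan (d := d) ι a) = n + 1 := by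
    intro a
    obtain ⟨p, v, hp, hv, hsym⟩ := JetPDE.exists_symbol_eq_span hinv hclass a
    obtain ⟨θ, hθa, hθ⟩ := hθ a
    rw [JetPDE.inducedCartan, ← hθa]
    exact JetPDE.finrank_comap_cartan
      (JetPDE.injective_dInclusion hι a) θ hθ
      (JetPDE.powTensor_ne_zero hp hv k) hsym
  have hC := JetPDE.isSmoothDistribution_of_hasCoordinateFrameAt
    (JetPDE.hasCoordinateFrameAt_inducedCartan hsm hrank)
  refine ⟨hC, fun a => ?_, fun p hp => ?_⟩
  · obtain ⟨p, v, hp, hv, hsym⟩ := JetPDE.exists_symbol_eq_span hinv hclass a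
    -- Positive degree matters here: a tensor of degree zero does not remember its covector.
    obtain ⟨l, rfl⟩ : ∃ l, k = l + 1 := Nat.exists_eq_succ_of_ne_zero (by omega)
    have huniq : ∀ P ∈ JetPDE.characteristicVariety d ι a, P = Projectivization.mk ℝ p hp := by
      rintro P ⟨v', hv', hP⟩
      rw [hsym] at hP
      obtain ⟨c, hc⟩ := JetPDE.eq_smul_of_powTensor_mem_span hp P.rep_nonzero hv' hP
      rw [← P.mk_rep, Projectivization.mk_eq_mk_iff']
      exact ⟨c, hc.symm⟩
    refine ⟨Projectivization.mk ℝ p hp, Set.eq_singleton_iff_unique_mem.mpr ⟨?_, huniq⟩⟩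
    obtain ⟨c, hc⟩ := Projectivization.exists_smul_eq_mk_rep ℝ p hp
    refine ⟨v, hv, ?_⟩
    have hpow : JetPDE.powTensor (Projectivization.mk ℝ p hp).rep (l + 1) v =
        (c : ℝ) ^ (l + 1) • JetPDE.powTensor p (l + 1) v := by
      rw [← hc]
      exact JetPDE.powTensor_smul _ _ _ _
    rw [hpow, hsym]
    exact Submodule.smul_mem _ _ (Submodule.mem_span_singleton_self _)
  · have hpar : ∀ a, ∃ T : LinearMap.ker (p a).rep →ₗ[ℝ] TangentSpace (𝓡 d) a,
        Function.Injective T ∧ LinearMap.range T = JetPDE.cauchyDistribution ι a ∧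
          ∀ w, (JetPDE.dInclusion ι a (T w)).1 = w := by
      intro a
      obtain ⟨p₀, v₀, -, -, hsym⟩ := JetPDE.exists_symbol_eq_span hinv hclass a
      obtain ⟨v, hv, hpv⟩ := hp a
      obtain ⟨θ, hθa, hθ⟩ := hθ a
      -- The symbol is a line, so the nonzero element given by the prescribed characteristic point
      -- also spans it; the radical is then computed with this representative.
      have hsym' : JetPDE.symbol (d := d) ι a = ℝ ∙ JetPDE.powTensor (p a).rep k v := by
        have hne := JetPDE.powTensor_ne_zero (p a).rep_nonzero hv k
        rw [hsym, Submodule.mem_span_singleton] at hpv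
        obtain ⟨c, hc⟩ := hpv
        have hc0 : c ≠ 0 := by
          rintro rfl
          exact hne (by rw [← hc, zero_smul])
        rw [hsym, ← hc, Submodule.span_singleton_smul_eq (IsUnit.mk0 c hc0)]
      rw [JetPDE.cauchyDistribution, JetPDE.inducedCartan, ← hθa]
      exact JetPDE.exists_parametrization_curvatureRadical hk (JetPDE.injective_dInclusion hι a) θ hθ
        (p a).rep_nonzero hv hsym'
    have hrankQ : ∀ a, Module.finrank ℝ (JetPDE.cauchyDistribution (d := d) ι a) = n - 1 := by
      intro a
      obtain ⟨T, hT, hrange, -⟩ := hpar a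
      rw [← hrange, LinearMap.finrank_range_of_inj hT]
      have := Module.Dual.finrank_ker_add_one_of_ne_zero (p a).rep_nonzero
      rw [Module.finrank_fin_fun] at this
      omega
    refine ⟨JetPDE.cauchyDistribution ι, ⟨JetPDE.isSmoothDistribution_of_hasCoordinateFrameAt
      (JetPDE.hasCoordinateFrameAt_cauchyDistribution hsm hrank hrankQ),
      fun a _ hx => hx.1, fun a => ?_,
      JetPDE.consistsOfCauchyCharacteristics_cauchyDistribution hsm⟩, ?_⟩
    · obtain ⟨T, -, hrange, hbase⟩ := hpar a
      rw [← hrange, ← LinearMap.range_comp]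
      have : JetPDE.dBase ι a ∘ₗ T = (LinearMap.ker (p a).rep).subtype :=
        LinearMap.ext fun w => (JetPDE.dBase_apply hsm a _).trans (hbase w)
      rw [this, Submodule.range_subtype]
    · rintro Q ⟨hQ, -, -, hcauchy⟩
      funext a
      have : FiniteDimensional ℝ (TangentSpace (𝓡 d) a) :=
        inferInstanceAs (FiniteDimensional ℝ (EuclideanSpace ℝ (Fin d)))
      -- A distribution of Cauchy characteristics sits inside the radical, and both have rank `n -
      -- 1`.
      exact Submodule.eq_of_le_of_finrank_eq (JetPDE.le_cauchyDistribution hsm hC hQ hcauchy a)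
        ((hQ.finrank_eq a).trans (hrankQ a).symm)
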